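/- **Definitions.** Let $\mathbf{C}$ be a monoidal category with tensor unit $I$ and unitors $\lambda,\rho$. A *half-braiding* on $U$ is a natural isomorphism $\sigma_A\colon U\otimes A\to A\otimes U$ with $\sigma_{A\otimes B}=(A\otimes\sigma_B)\circ(\sigma_A\otimes B)$ (suppressing associators); objects with half-braidings, and morphisms respecting them, form the centre of $\mathbf{C}$. A *central idempotent* is a morphism $u\colon U\to I$ in the centre with $\lambda_U\circ(u\otimes U)=\rho_U\circ(U\otimes u)$ such that this morphism $U\otimes U\to U$ is invertible. Let $\mathrm{ZI}(\mathbf{C})$ be the set of central idempotents, where $u$ and $v$ are identified if $u=v\circ m$ for an isomorphism $m$ of the centre; it is partially ordered by $u\le v$ iff $u=v\circ m$ for a morphism $m$ of the centre, and its greatest element $1$ is $\mathrm{id}_I$. $\mathbf{C}$ is *stiff* if for all objects $A$ and central idempotents $u\colon U\to I$, $v\colon V\to I$ the square with corners $A\otimes U\otimes V$, $A\otimes V$, $A\otimes U$, $A$ and sides induced by $u$ and $v$ is a pullback. $\mathbf{C}$ is *$\vee$-local* if $\mathrm{ZI}(\mathbf{C})$ has at least two elements and $u\vee w=1$ implies $u=1$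 or $w=1$; it is *$\bigvee$-local* if $\mathrm{ZI}(\mathbf{C})$ has at least two elements and $\bigvee_i u_i=1$ implies $u_i=1$ for some $i$. Let $\mathbf{MonCat}$ be the category of small monoidal categories and lax monoidal functors $F$ whose coherence morphism $\theta_I\colon I\to F(I)$ is invertible. A *sheaf of $\vee$-local (respectively $\bigvee$-local) monoidal categories* on a topological space $X$ is a sheaf $F\colon\mathcal{O}(X)^{\mathrm{op}}\to\mathbf{MonCat}$ that has, at each point $x\in X$, a stalk $\mathrm{colim}_{x\in W}F(W)$ in $\mathbf{MonCat}$ that is $\vee$-local (respectively $\bigvee$-local). Its *category of global sections* is $F(X)$. A *monoidal embedding* is a functor that is full, faithful and injective on objects, with a lax monoidal structure whose coherence morphisms are all invertible. A lax monoidal functor $F\colon\mathbf{C}\to\mathbf{D}$ with coherence morphisms $\theta$ *preserves central idempotents* if $\theta_I$ and all $\theta_{A,U}\colon F(A)\otimes F(U)\to F(A\otimes U)$, for $u\colon U\to I$ a central idempotent, are invertible, and for every central idempotent $u\colon U\to I$, with half-braiding $\sigma^U$, there is a chosen half-braiding $\tau^U$ on $F(U)$ in $\mathbf{D}$ such that $\theta_{A,U}\circ\tau^U_{F(A)}=F(\sigma^U_A)\circ\theta_{U,A}$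 for all $A$; $\tau^I$ is the canonical half-braiding of $I$ transported along $\theta_I$; $\tau^{U\otimes V}$ is the half-braiding composed of $\tau^U$ and $\tau^V$, transported along $\theta_{U,V}$; and $F(u)\colon F(U)\to F(I)$ respects $\tau^U$ and $\tau^I$. (In particular $\theta_I^{-1}\circ F(u)$ is then a central idempotent of $\mathbf{D}$.) **Corollary.** Let $\mathbf{C}$ be a small stiff monoidal category. 1. There are a topological space $X$, a sheaf $F$ of $\vee$-local monoidal categories on $X$, and a monoidal embedding $\mathbf{C}\to F(X)$ that preserves central idempotents. 2. There are a topological space $X$, a sheaf $F$ of $\bigvee$-local monoidal categories on $X$, and a monoidal embedding $\mathbf{C}\to F(X)$ that preserves central idempotents. -/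

import Mathlib

open CategoryTheory MonoidalCategory Functor.LaxMonoidal TopologicalSpace Opposite

universe u

namespace TensorTopology

section CentralIdempotents

variable {C : Type*} [Category C] [MonoidalCategory C]

variable (C) in
/-- A central idempotent of a monoidal category `C`: a morphism `u : U ⟶ I` of the (Drinfeld)
centre of `C` satisfying the central equation `λ_U ∘ (u ⊗ U) = ρ_U ∘ (U ⊗ u)`, such that this
morphism `U ⊗ U ⟶ U` is invertible. This is a representative; see `ZI` for the identification
of isomorphic ones. -/
structure CentralIdempotent where
  /-- the object `U`, with its half-braiding -/
  obj : Center C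
  /-- the morphism `u : U ⟶ I`, which respects the half-braidings -/
  hom : obj ⟶ 𝟙_ (Center C)
  central : hom ▷ obj ≫ (λ_ obj).hom = obj ◁ hom ≫ (ρ_ obj).hom
  isIso : IsIso (hom ▷ obj ≫ (λ_ obj).hom)

namespace CentralIdempotent

/-- The object of `C` underlying the domain of a central idempotent. -/
abbrev dom (u : CentralIdempotent C) : C := u.obj.1

/-- The morphism `U ⟶ I` of `C` underlying a central idempotent. -/
abbrev mor (u : CentralIdempotent C) : u.dom ⟶ 𝟙_ C := u.hom.f

/-- The half-braiding `U ⊗ A ≅ A ⊗ U` of a central idempotent. -/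
abbrev braid (u : CentralIdempotent C) (A : C) : u.dom ⊗ A ≅ A ⊗ u.dom := u.obj.2.β A

/-- A morphism of the centre that commutes with the maps to the tensor unit is unique. -/
theorem hom_unique (u v : CentralIdempotent C) (m n : u.obj ⟶ v.obj)
    (hm : m ≫ v.hom = u.hom) (hn : n ≫ v.hom = u.hom) : m = n := by
  have := u.isIso
  rw [← cancel_epi (u.hom ▷ u.obj ≫ (λ_ u.obj).hom)]
  have e1 : (u.hom ▷ u.obj ≫ (λ_ u.obj).hom) ≫ m =
      (n ⊗ₘ m) ≫ v.hom ▷ v.obj ≫ (λ_ v.obj).hom := by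
    rw [MonoidalCategory.tensorHom_def', Category.assoc, Category.assoc,
      ← comp_whiskerRight_assoc, hn, whisker_exchange_assoc, leftUnitor_naturality]
  have e2 : (u.hom ▷ u.obj ≫ (λ_ u.obj).hom) ≫ n =
      (n ⊗ₘ m) ≫ v.hom ▷ v.obj ≫ (λ_ v.obj).hom := by
    rw [u.central, v.central, MonoidalCategory.tensorHom_def, Category.assoc, Category.assoc,
      ← MonoidalCategory.whiskerLeft_comp_assoc, hm, ← whisker_exchange_assoc,
      rightUnitor_naturality]
  rw [e1, e2]

/-- Two central idempotents `u : U ⟶ I` and `v : V ⟶ I` are identified when `u = v ∘ m` for an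
isomorphism `m : U ⟶ V` that respects the half-braidings. -/
instance setoid : Setoid (CentralIdempotent C) where
  r u v := ∃ m : u.obj ≅ v.obj, m.hom ≫ v.hom = u.hom
  iseqv :=
    { refl := fun u => ⟨Iso.refl _, by simp⟩
      symm := fun {u v} ⟨m, hm⟩ => ⟨m.symm, by simp [← hm]⟩
      trans := fun {u v w} ⟨m, hm⟩ ⟨n, hn⟩ => ⟨m ≪≫ n, by simp [hn, hm]⟩ }

/-- `u ≤ v` for representatives: `u = v ∘ m` for some `m : U ⟶ V` that respects the
half-braidings. -/
def Le (u v : CentralIdempotent C) : Prop := ∃ m : u.obj ⟶ v.obj, m ≫ v.hom = u.hom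

variable (C) in
/-- The identity on the tensor unit is a central idempotent. -/
noncomputable def one : CentralIdempotent C where
  obj := 𝟙_ (Center C)
  hom := 𝟙 _
  central := by simp [unitors_equal]
  isIso := by
    rw [id_whiskerRight, Category.id_comp]
    infer_instance

/-- The tensor product `U ⊗ V ⟶ I ⊗ I ≅ I` of two central idempotents. -/
noncomputable def tensor (u v : CentralIdempotent C) : CentralIdempotent C where
  obj := u.obj ⊗ v.obj
  hom := (u.hom ⊗ₘ v.hom) ≫ (λ_ (𝟙_ (Center C))).hom
  central := by
    rw [tensor_left_unitality, tensor_right_unitality, comp_whiskerRight,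
      MonoidalCategory.whiskerLeft_comp, Category.assoc, Category.assoc,
      hom_inv_whiskerRight_assoc, whiskerLeft_hom_inv_assoc,
      tensorμ_natural_left_assoc, tensorμ_natural_right_assoc,
      tensorHom_comp_tensorHom, tensorHom_comp_tensorHom, u.central, v.central]
  isIso := by
    have := u.isIso
    have := v.isIso
    rw [tensor_left_unitality, comp_whiskerRight, Category.assoc,
      hom_inv_whiskerRight_assoc, tensorμ_natural_left_assoc, tensorHom_comp_tensorHom]
    have h : IsIso (tensorμ u.obj v.obj u.obj v.obj) :=
      ⟨tensorδ u.obj v.obj u.obj v.obj, tensorμ_tensorδ _ _ _ _, tensorδ_tensorμ _ _ _ _⟩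
    infer_instance

end CentralIdempotent

variable (C) in
/-- The set of central idempotents of `C`, up to isomorphisms that respect the morphisms to the
tensor unit and the half-braidings. -/
def ZI := Quotient (CentralIdempotent.setoid (C := C))

/-- Central idempotents are ordered by `u ≤ v` when `u` factors through `v` in the centre. -/
instance : PartialOrder (ZI C) where
  le := Quotient.lift₂ CentralIdempotent.Le (by
    rintro u v u' v' ⟨m, hm⟩ ⟨n, hn⟩
    refine propext ⟨?_, ?_⟩
    · rintro ⟨k, hk⟩
      exact ⟨m.inv ≫ k ≫ n.hom, by rw [Category.assoc, Category.assoc, hn, hk, ← hm,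
        Iso.inv_hom_id_assoc]⟩
    · rintro ⟨k, hk⟩
      exact ⟨m.hom ≫ k ≫ n.inv, by rw [Category.assoc, Category.assoc, ← hn,
        Iso.inv_hom_id_assoc, hk, hm]⟩)
  le_refl := by
    rintro ⟨u⟩
    exact ⟨𝟙 _, Category.id_comp _⟩
  le_trans := by
    rintro ⟨u⟩ ⟨v⟩ ⟨w⟩ ⟨m, hm⟩ ⟨n, hn⟩
    exact ⟨m ≫ n, by rw [Category.assoc, hn, hm]⟩
  le_antisymm := by
    rintro ⟨u⟩ ⟨v⟩ ⟨m, hm⟩ ⟨n, hn⟩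
    refine Quotient.sound ⟨⟨m, n, ?_, ?_⟩, hm⟩
    · exact u.hom_unique u _ _ (by rw [Category.assoc, hn, hm]) (Category.id_comp _)
    · exact v.hom_unique v _ _ (by rw [Category.assoc, hm, hn]) (Category.id_comp _)

/-- The identity on the tensor unit is the greatest central idempotent. -/
noncomputable instance : OrderTop (ZI C) where
  top := Quotient.mk _ (CentralIdempotent.one C)
  le_top := by
    rintro ⟨u⟩
    exact ⟨u.hom, Category.comp_id _⟩

variable (C) in
/-- A monoidal category is stiff when for all objects `A` and central idempotents `u : U ⟶ I` and
`v : V ⟶ I`, the square with corners `A ⊗ U ⊗ V`, `A ⊗ V`, `A ⊗ U` and `A`, whose sides are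
induced by `u` and `v`, is a pullback. -/
def IsStiff : Prop :=
  ∀ (A : C) (u v : CentralIdempotent C),
    IsPullback
      ((A ◁ u.mor ≫ (ρ_ A).hom) ▷ v.dom : (A ⊗ u.dom) ⊗ v.dom ⟶ A ⊗ v.dom)
      ((A ⊗ u.dom) ◁ v.mor ≫ (ρ_ (A ⊗ u.dom)).hom : (A ⊗ u.dom) ⊗ v.dom ⟶ A ⊗ u.dom)
      (A ◁ v.mor ≫ (ρ_ A).hom)
      (A ◁ u.mor ≫ (ρ_ A).hom)

end CentralIdempotents

section Locality

/-- A partially ordered set with greatest element `1` is `∨`-local when it has at least two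
elements, and `u ∨ w = 1` (the join exists and is `1`) only if `u = 1` or `w = 1`. -/
def IsVeeLocalOrder (P : Type*) [PartialOrder P] [OrderTop P] : Prop :=
  Nontrivial P ∧ ∀ u w : P, IsLUB {u, w} ⊤ → u = ⊤ ∨ w = ⊤

/-- A partially ordered set with greatest element `1` is `⋁`-local when it has at least two
elements, and a family has join `1` only if one of its members is `1`. -/
def IsBigveeLocalOrder (P : Type*) [PartialOrder P] [OrderTop P] : Prop :=
  Nontrivial P ∧ ∀ S : Set P, IsLUB S ⊤ → ⊤ ∈ S

end Locality

/-- Small monoidal categories. -/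
structure MonCategory : Type (u + 1) where
  of ::
  /-- the objects -/
  carrier : Type u
  [cat : SmallCategory carrier]
  [mon : MonoidalCategory carrier]

namespace MonCategory

instance : CoeSort MonCategory.{u} (Type u) := ⟨MonCategory.carrier⟩

attribute [instance] MonCategory.cat MonCategory.mon

/-- A morphism of small monoidal categories: a lax monoidal functor `F` whose coherence
morphism `I ⟶ F(I)` is invertible. -/
structure Hom (C D : MonCategory.{u}) where
  /-- the underlying functor -/
  functor : C ⥤ D
  [lax : functor.LaxMonoidal]
  isIso_unit : IsIso (ε functor)

attribute [instance] Hom.lax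

theorem Hom.ext' {C D : MonCategory.{u}} (F : C ⥤ D) (a b : F.LaxMonoidal)
    (ha : IsIso a.ε) (hb : IsIso b.ε) (h : a = b) :
    (@Hom.mk C D F a ha) = @Hom.mk C D F b hb := by
  subst h
  rfl

/-- Small monoidal categories and lax monoidal functors with invertible unit coherence form a
category, under strict equality of functors and of coherence morphisms. -/
instance : Category MonCategory.{u} where
  Hom := Hom
  id C := { functor := 𝟭 C, isIso_unit := by rw [id_ε]; infer_instance }
  comp F G :=
    { functor := F.functor ⋙ G.functor
      isIso_unit := by
        have := F.isIso_unit
        have := G.isIso_unit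
        rw [comp_ε]
        infer_instance }
  id_comp F := by
    obtain ⟨F, h⟩ := F
    apply Hom.ext'
    apply Functor.LaxMonoidal.ext
    · exact (congrArg (ε F ≫ ·) (F.map_id _)).trans (Category.comp_id _)
    · funext X Y
      exact (congrArg (μ F X Y ≫ ·) (F.map_id _)).trans (Category.comp_id _)
  comp_id F := by
    obtain ⟨F, h⟩ := F
    apply Hom.ext'
    apply Functor.LaxMonoidal.ext
    · exact Category.id_comp _
    · funext X Y
      exact Category.id_comp _
  assoc F G H := by
    obtain ⟨F, hF⟩ := F
    obtain ⟨G, hG⟩ := G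
    obtain ⟨H, hH⟩ := H
    apply Hom.ext'
    apply Functor.LaxMonoidal.ext
    · exact (congrArg (ε H ≫ ·) (H.map_comp _ _)).trans (Category.assoc _ _ _).symm
    · funext X Y
      exact (congrArg (μ H _ _ ≫ ·) (H.map_comp _ _)).trans (Category.assoc _ _ _).symm

/-- The functor underlying a morphism of small monoidal categories. -/
def toFunctor {C D : MonCategory.{u}} (F : C ⟶ D) : C ⥤ D := Hom.functor F

instance {C D : MonCategory.{u}} (F : C ⟶ D) : (toFunctor F).LaxMonoidal := Hom.lax F

/-- A monoidal category is `∨`-local when its set of central idempotents is. -/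
def IsVeeLocal (C : MonCategory.{u}) : Prop := IsVeeLocalOrder (ZI C)

/-- A monoidal category is `⋁`-local when its set of central idempotents is. -/
def IsBigveeLocal (C : MonCategory.{u}) : Prop := IsBigveeLocalOrder (ZI C)

end MonCategory

/-- A presheaf of monoidal categories on `X` is a sheaf of monoidal categories with property `P`
when it is a sheaf, and at each point `x` it has a stalk (a colimit, in the category of small
monoidal categories, over the open neighbourhoods of `x`) with property `P`. -/
def IsSheafOf (P : MonCategory.{u} → Prop) {X : TopCat.{u}}
    (F : TopCat.Presheaf MonCategory.{u} X) : Prop :=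
  F.IsSheaf ∧ ∀ x : X, ∃ c : Limits.Cocone ((OpenNhds.inclusion x).op ⋙ F),
    Nonempty (Limits.IsColimit c) ∧ P c.pt

/-- The monoidal category of global sections of a presheaf of monoidal categories. -/
def globalSections {X : TopCat.{u}} (F : TopCat.Presheaf MonCategory.{u} X) : MonCategory.{u} :=
  F.obj (op ⊤)

section Functors

variable {C D : Type*} [Category C] [MonoidalCategory C] [Category D] [MonoidalCategory D]

/-- A lax monoidal functor `F` preserves central idempotents when its coherence morphisms
`I ⟶ F(I)` and `F(A) ⊗ F(U) ⟶ F(A ⊗ U)` are invertible for all objects `A` and central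
idempotents `u`, and each `F(U)` has a chosen half-braiding such that:
* it restricts to the half-braiding of `U` on objects in the image of `F`;
* the one on `F(I)` is the canonical one, and the one on `F(U ⊗ V)` is the one
  induced by those on `F(U)` and `F(V)`;
* `F(u) : F(U) ⟶ F(I)` respects the chosen half-braidings. -/
def PreservesCentralIdempotents (F : C ⥤ D) [F.LaxMonoidal] : Prop :=
  IsIso (ε F) ∧ (∀ (A : C) (u : CentralIdempotent C), IsIso (μ F A u.dom)) ∧
  ∃ b : ∀ u : CentralIdempotent C, HalfBraiding (F.obj u.dom),
    (∀ (u : CentralIdempotent C) (A : C),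
      ((b u).β (F.obj A)).hom ≫ μ F A u.dom = μ F u.dom A ≫ F.map (u.braid A).hom) ∧
    (∀ X : D, ε F ▷ X ≫ ((b (CentralIdempotent.one C)).β X).hom =
      (λ_ X).hom ≫ (ρ_ X).inv ≫ X ◁ ε F) ∧
    (∀ (u v : CentralIdempotent C) (X : D),
      μ F u.dom v.dom ▷ X ≫ ((b (u.tensor v)).β X).hom =
        (α_ _ _ _).hom ≫ F.obj u.dom ◁ ((b v).β X).hom ≫ (α_ _ _ _).inv ≫
          ((b u).β X).hom ▷ F.obj v.dom ≫ (α_ _ _ _).hom ≫ X ◁ μ F u.dom v.dom) ∧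
    (∀ (u : CentralIdempotent C) (X : D),
      F.map u.mor ▷ X ≫ ((b (CentralIdempotent.one C)).β X).hom =
        ((b u).β X).hom ≫ X ◁ F.map u.mor)

/-- A monoidal embedding: a full and faithful functor that is injective on objects, all of whose
monoidal coherence morphisms are invertible. -/
structure IsMonoidalEmbedding (F : C ⥤ D) [F.LaxMonoidal] : Prop where
  full : F.Full
  faithful : F.Faithful
  injective_obj : Function.Injective F.obj
  isIso_unit : IsIso (ε F)
  isIso_tensor : ∀ A B : C, IsIso (μ F A B)

end Functors

/-- The monoidal category `D` admits a monoidal embedding of `C`, given by a morphism of small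
monoidal categories, that preserves central idempotents. -/
def HasCentralEmbedding (C D : MonCategory.{u}) : Prop :=
  ∃ Φ : C ⟶ D, IsMonoidalEmbedding (MonCategory.toFunctor Φ) ∧
    PreservesCentralIdempotents (MonCategory.toFunctor Φ)

end TensorTopology

/-! For a central idempotent `u : U ⟶ I`, stiffness makes `A ⊗ U ⟶ A` a subobject of `A`, and the
intersection of two such subobjects is `A ⊗ U ⊗ V`. A lower set `J` of central idempotents therefore
cuts out of the presheaf represented by `A` the subpresheaf of morphisms supported in `J`.

The space is `ZI C` with the lower sets as open sets. A section over a nonempty `W` is a pair `(J,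
A)`, standing for the presheaf of morphisms into `A` supported in `J ⊓ W`; morphisms of sections are
maps of these presheaves. The tensor product is `(J ⊓ K, A ⊗ B)`, and maps extend to it because the
domain of a central idempotent can be moved past any object (`Supp.exists_extension`).

A support is witnessed by a single central idempotent, which lies in one member of any open cover,
so morphisms glue (`Sections.exists_hom_of_cover`). Objects glue strictly, since a pair does not
change under restriction and any two nonempty open sets meet (`Sections.exists_obj_of_cover`).

The stalk at `u` is the category of sections over `↓u`. A central idempotent `w` there whose support
contains `u` descends to a central idempotent of `C` below `u`. If it equals `u`, then `w` is
invertible; in every other case `w` factors through the ideal of elements strictly below `u`. So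
there is a largest central idempotent other than `1` (`Sections.isBigveeLocalOrder_Iic`), and the
same sheaf serves both parts. Over the whole space identities are supported, so by the Yoneda
argument `A ↦ (⊤, A)` is full and faithful. -/

namespace TensorTopology

/-! ### Central idempotents as subobjects `A ⊗ U ⟶ A` -/

section Support

variable {C : Type*} [Category C] [MonoidalCategory C]

namespace CentralIdempotent

/-- The morphism `A ⊗ U ⟶ A` induced by a central idempotent `u : U ⟶ I`. -/
def proj (u : CentralIdempotent C) (A : C) : A ⊗ u.dom ⟶ A := A ◁ u.mor ≫ (ρ_ A).hom

theorem proj_naturality (u : CentralIdempotent C) {A B : C} (f : A ⟶ B) :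
    f ▷ u.dom ≫ u.proj B = u.proj A ≫ f := by
  simp [proj, ← whisker_exchange_assoc]

theorem associator_proj (u : CentralIdempotent C) (A B : C) :
    (α_ A B u.dom).hom ≫ A ◁ u.proj B = u.proj (A ⊗ B) := by
  simp [proj]

theorem mor_comm (u : CentralIdempotent C) (A : C) :
    u.mor ▷ A ≫ (λ_ A).hom = (u.braid A).hom ≫ u.proj A := by
  have h : u.mor ▷ A ≫ (λ_ A).hom ≫ (ρ_ A).inv = (u.braid A).hom ≫ A ◁ u.mor := u.hom.comm A
  rw [proj, ← reassoc_of% h, Iso.inv_hom_id, Category.comp_id]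

theorem central_mor (u : CentralIdempotent C) :
    u.mor ▷ u.dom ≫ (λ_ u.dom).hom = u.proj u.dom :=
  congrArg Center.Hom.f u.central

instance isIso_proj_dom (u : CentralIdempotent C) : IsIso (u.proj u.dom) := by
  have := u.isIso
  have h : IsIso ((Center.forget C).map (u.hom ▷ u.obj ≫ (λ_ u.obj).hom)) := inferInstance
  rw [← u.central_mor]
  exact h

/-- Idempotence at every object: up to an associator this is `A` tensored with the invertible `U ⊗ U
⟶ U`. -/
instance isIso_proj_tensor (u : CentralIdempotent C) (A : C) : IsIso (u.proj (A ⊗ u.dom)) := by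
  rw [← associator_proj]
  infer_instance

theorem whiskerLeft_proj (u v : CentralIdempotent C) (m : u.obj ⟶ v.obj) (h : m ≫ v.hom = u.hom)
    (A : C) : A ◁ m.f ≫ v.proj A = u.proj A := by
  have h' : m.f ≫ v.mor = u.mor := congrArg Center.Hom.f h
  rw [proj, ← MonoidalCategory.whiskerLeft_comp_assoc, h', proj]

/-- The isomorphism moving `U` past `Z`. -/
def shuffle (u : CentralIdempotent C) (A Z : C) : (A ⊗ u.dom) ⊗ Z ≅ (A ⊗ Z) ⊗ u.dom :=
  α_ _ _ _ ≪≫ whiskerLeftIso A (u.braid Z) ≪≫ (α_ _ _ _).symm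

theorem shuffle_proj (u : CentralIdempotent C) (A Z : C) :
    (u.shuffle A Z).hom ≫ u.proj (A ⊗ Z) = u.proj A ▷ Z := by
  rw [← associator_proj]
  simp only [shuffle, Iso.trans_hom, whiskerLeftIso_hom, Iso.symm_hom, Category.assoc,
    Iso.inv_hom_id_assoc, ← MonoidalCategory.whiskerLeft_comp, ← mor_comm]
  simp [proj]

/-- The class of a central idempotent. -/
def toZI (u : CentralIdempotent C) : ZI C := Quotient.mk _ u

theorem exists_toZI_eq (z : ZI C) : ∃ u : CentralIdempotent C, u.toZI = z := Quotient.exists_rep z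

theorem toZI_le_toZI {u v : CentralIdempotent C} :
    u.toZI ≤ v.toZI ↔ ∃ m : u.obj ⟶ v.obj, m ≫ v.hom = u.hom :=
  Iff.rfl

theorem exists_comp_proj_tensor (u v : CentralIdempotent C) (A : C) :
    ∃ s : (A ⊗ u.dom) ⊗ v.dom ⟶ A ⊗ (u.tensor v).dom,
      s ≫ (u.tensor v).proj A = v.proj (A ⊗ u.dom) ≫ u.proj A := by
  refine ⟨(α_ A u.dom v.dom).hom, ?_⟩
  change (α_ A u.dom v.dom).hom ≫ A ◁ ((u.mor ⊗ₘ v.mor) ≫ (λ_ (𝟙_ C)).hom) ≫ (ρ_ A).hom = _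
  rw [← proj_naturality]
  simp only [proj, MonoidalCategory.tensorHom_def]
  monoidal

theorem toZI_tensor_le_left (u v : CentralIdempotent C) :
    (u.tensor v).toZI ≤ u.toZI := by
  refine toZI_le_toZI.2 ⟨u.obj ◁ v.hom ≫ (ρ_ _).hom, ?_⟩
  change (u.obj ◁ v.hom ≫ (ρ_ u.obj).hom) ≫ u.hom = (u.hom ⊗ₘ v.hom) ≫ (λ_ (𝟙_ (Center C))).hom
  simp [MonoidalCategory.tensorHom_def', unitors_equal]

theorem toZI_tensor_le_right (u v : CentralIdempotent C) :
    (u.tensor v).toZI ≤ v.toZI := by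
  refine toZI_le_toZI.2 ⟨u.hom ▷ v.obj ≫ (λ_ _).hom, ?_⟩
  change (u.hom ▷ v.obj ≫ (λ_ v.obj).hom) ≫ v.hom = (u.hom ⊗ₘ v.hom) ≫ (λ_ (𝟙_ (Center C))).hom
  simp [MonoidalCategory.tensorHom_def]

theorem proj_proj (u v : CentralIdempotent C) (A : C) :
    v.proj (A ⊗ u.dom) ≫ u.proj A = u.proj A ▷ v.dom ≫ v.proj A :=
  (proj_naturality v (u.proj A)).symm

end CentralIdempotent

/-- A functor that moves past tensoring with the domains of central idempotents. -/
def CommutesWithProj (Φ : C ⥤ C) : Prop :=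
  ∀ (u : CentralIdempotent C) (A : C), ∃ s : Φ.obj (A ⊗ u.dom) ≅ Φ.obj A ⊗ u.dom,
    s.hom ≫ u.proj (Φ.obj A) = Φ.map (u.proj A)

/-- The half-braiding is needed here to carry `U` across `Z`; on the other side the associator
suffices. -/
theorem commutesWithProj_tensorRight (Z : C) : CommutesWithProj (tensorRight Z) :=
  fun u A => ⟨u.shuffle A Z, u.shuffle_proj A Z⟩

theorem commutesWithProj_tensorLeft (Z : C) : CommutesWithProj (tensorLeft Z) :=
  fun u A => ⟨(α_ Z A u.dom).symm, by
    change (α_ Z A u.dom).inv ≫ u.proj (Z ⊗ A) = Z ◁ u.proj A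
    rw [← CentralIdempotent.associator_proj, Iso.inv_hom_id_assoc]⟩

variable [hC : Fact (IsStiff C)]

namespace CentralIdempotent

theorem isPullback_proj (u v : CentralIdempotent C) (A : C) :
    IsPullback (u.proj A ▷ v.dom) (v.proj (A ⊗ u.dom)) (v.proj A) (u.proj A) :=
  hC.out A u v

/-- Stiffness with `v = u` describes the kernel pair of `u.proj A`; the central equation makes its
two projections equal. -/
instance mono_proj (u : CentralIdempotent C) (A : C) : Mono (u.proj A) where
  right_cancellation {T} g h e := by
    have sq := u.isPullback_proj u A
    have key : u.proj A ▷ u.dom = u.proj (A ⊗ u.dom) := by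
      rw [← associator_proj, ← central_mor]
      simp [proj]
    exact (sq.lift_fst g h e).symm.trans ((congrArg _ key).trans (sq.lift_snd g h e))

instance mono_proj_whiskerRight (u : CentralIdempotent C) (A Z : C) : Mono (u.proj A ▷ Z) := by
  rw [← shuffle_proj]
  infer_instance

instance mono_whiskerLeft_proj (u : CentralIdempotent C) (A Z : C) : Mono (Z ◁ u.proj A) := by
  have : Z ◁ u.proj A = (α_ _ _ _).inv ≫ u.proj (Z ⊗ A) := by
    rw [← associator_proj, Iso.inv_hom_id_assoc]
  rw [this]
  infer_instance

instance mono_whiskerLeft_mor (u : CentralIdempotent C) (A : C) : Mono (A ◁ u.mor) := by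
  have : Mono (A ◁ u.mor ≫ (ρ_ A).hom) := u.mono_proj A
  exact mono_of_mono _ (ρ_ A).hom

end CentralIdempotent

theorem CommutesWithProj.mono {Φ : C ⥤ C} (hΦ : CommutesWithProj Φ) (u : CentralIdempotent C)
    (A : C) : Mono (Φ.map (u.proj A)) := by
  obtain ⟨s, hs⟩ := hΦ u A
  rw [← hs]
  infer_instance

/-- Two factorisations through `Φ.map (u.proj A)` and `Φ.map (v.proj A)` have a common
refinement. -/
theorem CommutesWithProj.exists_refinement {Φ : C ⥤ C} (hΦ : CommutesWithProj Φ)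
    (u v : CentralIdempotent C) {A T : C} (g : T ⟶ Φ.obj (A ⊗ u.dom)) (h : T ⟶ Φ.obj (A ⊗ v.dom))
    (e : g ≫ Φ.map (u.proj A) = h ≫ Φ.map (v.proj A)) :
    ∃ k : T ⟶ Φ.obj ((A ⊗ u.dom) ⊗ v.dom),
      k ≫ Φ.map (v.proj (A ⊗ u.dom)) = g ∧ k ≫ Φ.map (u.proj A ▷ v.dom) = h := by
  -- Stiffness is applied at `Φ.obj A`, and the result is carried back through the isomorphisms
  -- supplied by `hΦ`.
  have sq := u.isPullback_proj v (Φ.obj A)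
  obtain ⟨s, hs⟩ := hΦ u A
  obtain ⟨t, ht⟩ := hΦ v A
  obtain ⟨r, hr⟩ := hΦ v (A ⊗ u.dom)
  have e' : (h ≫ t.hom) ≫ v.proj (Φ.obj A) = (g ≫ s.hom) ≫ u.proj (Φ.obj A) := by
    simp only [Category.assoc, hs, ht, e]
  have := hΦ.mono v A
  obtain ⟨l, -, h₁⟩ : ∃ l, l ≫ _ = _ ∧ l ≫ _ = _ := ⟨_, sq.lift_fst _ _ e', sq.lift_snd _ _ e'⟩
  have key : (l ≫ s.inv ▷ v.dom ≫ r.inv) ≫ Φ.map (v.proj (A ⊗ u.dom)) = g := by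
    rw [← cancel_mono s.hom, ← h₁, ← hr]
    simp only [Category.assoc, Iso.inv_hom_id_assoc]
    rw [reassoc_of% CentralIdempotent.proj_naturality, Iso.inv_hom_id, Category.comp_id]
  refine ⟨_, key, ?_⟩
  -- The second leg follows from the first by cancelling a monomorphism.
  rw [← cancel_mono (Φ.map (v.proj A)), ← e, ← key]
  simp only [Category.assoc, ← Functor.map_comp, CentralIdempotent.proj_proj]

end Support

/-! ### Morphisms supported in a lower set of central idempotents -/

section Support

variable {C : Type*} [Category C] [MonoidalCategory C]

/-- A morphism `T ⟶ A` is supported in a lower set `J` of central idempotents when it factors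
through `A ⊗ U ⟶ A` for some `u : U ⟶ I` in `J`. -/
def Supp (J : LowerSet (ZI C)) {T A : C} (f : T ⟶ A) : Prop :=
  ∃ u : CentralIdempotent C, u.toZI ∈ J ∧ ∃ g : T ⟶ A ⊗ u.dom, g ≫ u.proj A = f

namespace Supp

variable {J K : LowerSet (ZI C)} {S T A B : C}

theorem mono (h : J ≤ K) {f : T ⟶ A} (hf : Supp J f) : Supp K f := by
  obtain ⟨u, hu, g, rfl⟩ := hf
  exact ⟨u, h hu, g, rfl⟩

theorem precomp {f : T ⟶ A} (hf : Supp J f) (g : S ⟶ T) : Supp J (g ≫ f) := by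
  obtain ⟨u, hu, k, rfl⟩ := hf
  exact ⟨u, hu, g ≫ k, Category.assoc _ _ _⟩

theorem postcomp {f : T ⟶ A} (hf : Supp J f) (g : A ⟶ B) : Supp J (f ≫ g) := by
  obtain ⟨u, hu, k, rfl⟩ := hf
  exact ⟨u, hu, k ≫ g ▷ u.dom, by simp [u.proj_naturality]⟩

theorem proj {u : CentralIdempotent C} (hu : u.toZI ∈ J) (A : C) : Supp J (u.proj A) :=
  ⟨u, hu, 𝟙 _, Category.id_comp _⟩

/-- By idempotence the identity of `A ⊗ U` factors through `(A ⊗ U) ⊗ U`, so it is supported at `u`,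
and so is anything composed with it. -/
theorem of_dom {u : CentralIdempotent C} (hu : u.toZI ∈ J) (f : A ⊗ u.dom ⟶ B) : Supp J f := by
  have h := ((proj hu (A ⊗ u.dom)).precomp (inv (u.proj (A ⊗ u.dom)))).postcomp f
  rwa [IsIso.inv_hom_id, Category.id_comp] at h

theorem map {Φ : C ⥤ C} (hΦ : CommutesWithProj Φ) {f : T ⟶ A} (hf : Supp J f) :
    Supp J (Φ.map f) := by
  obtain ⟨u, hu, g, rfl⟩ := hf
  obtain ⟨s, hs⟩ := hΦ u A
  exact ⟨u, hu, Φ.map g ≫ s.hom, by rw [Category.assoc, hs, Φ.map_comp]⟩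

theorem whiskerRight {f : T ⟶ A} (hf : Supp J f) (Z : C) : Supp J (f ▷ Z) :=
  hf.map (commutesWithProj_tensorRight Z)

theorem whiskerLeft {f : T ⟶ A} (hf : Supp J f) (Z : C) : Supp J (Z ◁ f) :=
  hf.map (commutesWithProj_tensorLeft Z)

theorem exists_eq_comp_map {Φ : C ⥤ C} (hΦ : CommutesWithProj Φ) {f : T ⟶ Φ.obj A}
    (hf : Supp J f) : ∃ u : CentralIdempotent C, u.toZI ∈ J ∧
      ∃ g : T ⟶ Φ.obj (A ⊗ u.dom), f = g ≫ Φ.map (u.proj A) := by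
  obtain ⟨u, hu, g, rfl⟩ := hf
  obtain ⟨s, hs⟩ := hΦ u A
  exact ⟨u, hu, g ≫ s.inv, by rw [Category.assoc, ← hs, Iso.inv_hom_id_assoc]⟩

theorem exists_eq_comp_whiskerRight {f : T ⟶ A ⊗ B} (hf : Supp J f) :
    ∃ u : CentralIdempotent C, u.toZI ∈ J ∧
      ∃ g : T ⟶ (A ⊗ u.dom) ⊗ B, f = g ≫ u.proj A ▷ B :=
  exists_eq_comp_map (commutesWithProj_tensorRight B) hf

theorem exists_eq_comp_whiskerLeft {f : T ⟶ A ⊗ B} (hf : Supp J f) :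
    ∃ u : CentralIdempotent C, u.toZI ∈ J ∧
      ∃ g : T ⟶ A ⊗ (B ⊗ u.dom), f = g ≫ A ◁ u.proj B :=
  exists_eq_comp_map (commutesWithProj_tensorLeft A) hf

theorem exists_eq_comp_proj {f : T ⟶ A} (hf : Supp J f) : ∃ u : CentralIdempotent C,
    u.toZI ∈ J ∧ ∃ g : T ⟶ A ⊗ u.dom, f = g ≫ u.proj A := by
  obtain ⟨u, hu, g, rfl⟩ := hf
  exact ⟨u, hu, g, rfl⟩

/-- Idempotence duplicates `U`, and the half-braiding distributes one copy to each factor. -/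
theorem exists_eq_comp_tensorHom {f : T ⟶ A ⊗ B} (hf : Supp J f) :
    ∃ u : CentralIdempotent C, u.toZI ∈ J ∧
      ∃ g : T ⟶ (A ⊗ u.dom) ⊗ (B ⊗ u.dom), f = g ≫ (u.proj A ⊗ₘ u.proj B) := by
  obtain ⟨u, hu, g, rfl⟩ := exists_eq_comp_proj hf
  refine ⟨u, hu, g ≫ inv (u.proj ((A ⊗ B) ⊗ u.dom)) ≫ (α_ A B u.dom).hom ▷ u.dom ≫
    (u.shuffle A (B ⊗ u.dom)).inv, ?_⟩
  rw [MonoidalCategory.tensorHom_def, ← u.shuffle_proj]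
  simp [reassoc_of% u.proj_naturality, u.associator_proj]

variable [hC : Fact (IsStiff C)]

/-- Two factorisations combine through the stiffness pullback `A ⊗ U ⊗ V`, and `U ⊗ V` lies below
both `U` and `V`. -/
theorem inf {f : T ⟶ A} (hJ : Supp J f) (hK : Supp K f) : Supp (J ⊓ K) f := by
  obtain ⟨u, hu, g, rfl⟩ := hJ
  obtain ⟨v, hv, h, e⟩ := hK
  have sq := u.isPullback_proj v A
  obtain ⟨s, hs⟩ := u.exists_comp_proj_tensor v A
  refine ⟨u.tensor v, ⟨J.lower (u.toZI_tensor_le_left v) hu,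
    K.lower (u.toZI_tensor_le_right v) hv⟩, sq.lift h g e ≫ s, ?_⟩
  rw [Category.assoc, hs, sq.lift_snd_assoc]

theorem tensorHom {f : S ⟶ A} (hf : Supp J f) {g : T ⟶ B} (hg : Supp K g) :
    Supp (J ⊓ K) (f ⊗ₘ g) := by
  refine inf ?_ ?_
  · rw [MonoidalCategory.tensorHom_def]
    exact (hf.whiskerRight T).postcomp _
  · rw [MonoidalCategory.tensorHom_def]
    exact (hg.whiskerLeft A).precomp _

/-- Natural operations on supported morphisms `T ⟶ A` extend along functors that commute with
central idempotents. -/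
theorem exists_extension {Φ : C ⥤ C} (hΦ : CommutesWithProj Φ)
    (φ : ∀ {T : C} (f : T ⟶ A), Supp J f → (T ⟶ B))
    (hφ : ∀ {S T : C} (g : S ⟶ T) (f : T ⟶ A) (hf : Supp J f),
      φ (g ≫ f) (hf.precomp g) = g ≫ φ f hf)
    (hK : K ≤ J) (f : T ⟶ Φ.obj A) (hf : Supp K f) :
    ∃ g : T ⟶ Φ.obj B, Supp K g ∧ ∀ {S : C} (k : S ⟶ A) (hk : Supp J k) (l : T ⟶ Φ.obj S),
      l ≫ Φ.map k = f → g = l ≫ Φ.map (φ k hk) := by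
  obtain ⟨u, hu, l₀, rfl⟩ := exists_eq_comp_map hΦ hf
  -- The required formula, applied to `k = u.proj A`, forces this value.
  refine ⟨l₀ ≫ Φ.map (φ (u.proj A) (proj (hK hu) A)), ((of_dom hu _).map hΦ).precomp _, ?_⟩
  intro S k hk l e
  obtain ⟨v, hv, k₀, rfl⟩ := exists_eq_comp_proj hk
  -- The two factorisations of `f` have a common refinement, where naturality of `φ` identifies the
  -- two values.
  obtain ⟨m, rfl, hm⟩ := hΦ.exists_refinement u v l₀ (l ≫ Φ.map k₀)
    (by rw [← e, Category.assoc, Φ.map_comp])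
  rw [hφ k₀ _ (proj hv A), Φ.map_comp, reassoc_of% hm.symm, Category.assoc, ← Φ.map_comp,
    ← Φ.map_comp, ← hφ _ _ (proj (hK hu) A), ← hφ _ _ (proj hv A)]
  simp only [u.proj_proj]

end Supp

end Support

/-! ### The monoidal category of sections over an open set -/

section Sections

variable {C : Type*} [Category C] [MonoidalCategory C]

/-- The objects of the category of sections, over an open set `W` of the spectrum, of the
completion of `C` under joins of central idempotents: an object `A` of `C` together with a lower
set of central idempotents, to be thought of as their join tensored with `A`. There is only one
such object when `W` is empty. -/
@[ext]
structure Sections (W : LowerSet (ZI C)) where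
  /-- the lower set of central idempotents -/
  supp : (W : Set (ZI C)).Nonempty → LowerSet (ZI C)
  /-- the object of `C` -/
  obj : (W : Set (ZI C)).Nonempty → C

namespace Sections

variable {W : LowerSet (ZI C)}

/-- Morphisms of sections: natural operations on supported morphisms. -/
structure Hom (X Y : Sections W) where
  /-- the operation -/
  app : ∀ (h : (W : Set (ZI C)).Nonempty) {T : C} (f : T ⟶ X.obj h),
    Supp (X.supp h ⊓ W) f → (T ⟶ Y.obj h)
  supp : ∀ (h : (W : Set (ZI C)).Nonempty) {T : C} (f : T ⟶ X.obj h)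
    (hf : Supp (X.supp h ⊓ W) f), Supp (Y.supp h ⊓ W) (app h f hf)
  naturality : ∀ (h : (W : Set (ZI C)).Nonempty) {S T : C} (g : S ⟶ T) (f : T ⟶ X.obj h)
    (hf : Supp (X.supp h ⊓ W) f), app h (g ≫ f) (hf.precomp g) = g ≫ app h f hf

instance : Category (Sections W) where
  Hom := Hom
  id X :=
    { app := fun _ _ f _ => f
      supp := fun _ _ _ hf => hf
      naturality := fun _ _ _ _ _ _ => rfl }
  comp φ ψ :=
    { app := fun h _ f hf => ψ.app h (φ.app h f hf) (φ.supp h f hf)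
      supp := fun h _ f hf => ψ.supp h _ _
      naturality := fun h _ _ g f hf => by
        simp only [φ.naturality h g f hf]
        exact ψ.naturality h g _ _ }

/-- The operation underlying a morphism of sections. -/
def app {X Y : Sections W} (φ : X ⟶ Y) (h : (W : Set (ZI C)).Nonempty) {T : C}
    (f : T ⟶ X.obj h) (hf : Supp (X.supp h ⊓ W) f) : T ⟶ Y.obj h := Hom.app φ h f hf

theorem supp_app {X Y : Sections W} (φ : X ⟶ Y) (h : (W : Set (ZI C)).Nonempty) {T : C}
    (f : T ⟶ X.obj h) (hf : Supp (X.supp h ⊓ W) f) : Supp (Y.supp h ⊓ W) (app φ h f hf) :=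
  Hom.supp φ h f hf

theorem app_comp_left {X Y : Sections W} (φ : X ⟶ Y) (h : (W : Set (ZI C)).Nonempty) {S T : C}
    (g : S ⟶ T) (f : T ⟶ X.obj h) (hf : Supp (X.supp h ⊓ W) f)
    (hgf : Supp (X.supp h ⊓ W) (g ≫ f)) :
    app φ h (g ≫ f) hgf = g ≫ app φ h f hf := Hom.naturality φ h g f hf

@[simp]
theorem app_id (X : Sections W) (h : (W : Set (ZI C)).Nonempty) {T : C}
    (f : T ⟶ X.obj h) (hf : Supp (X.supp h ⊓ W) f) : app (𝟙 X) h f hf = f := rfl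

@[simp]
theorem app_comp {X Y Z : Sections W} (φ : X ⟶ Y) (ψ : Y ⟶ Z)
    (h : (W : Set (ZI C)).Nonempty) {T : C} (f : T ⟶ X.obj h) (hf : Supp (X.supp h ⊓ W) f) :
    app (φ ≫ ψ) h f hf = app ψ h (app φ h f hf) (supp_app φ h f hf) := rfl

theorem hom_ext {X Y : Sections W} {φ ψ : X ⟶ Y}
    (e : ∀ (h : (W : Set (ZI C)).Nonempty) {T : C} (f : T ⟶ X.obj h)
      (hf : Supp (X.supp h ⊓ W) f), app φ h f hf = app ψ h f hf) : φ = ψ := by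
  obtain ⟨a, _, _⟩ := φ
  obtain ⟨b, _, _⟩ := ψ
  obtain rfl : @a = @b := by
    funext h T f hf
    exact e h f hf
  rfl

/-- The morphism of sections given by composition with a morphism of `C`. -/
def ofHom {X Y : Sections W} (k : ∀ h, X.obj h ⟶ Y.obj h) (hk : ∀ h, X.supp h ≤ Y.supp h) :
    X ⟶ Y :=
  Hom.mk (fun h _ f _ => f ≫ k h)
    (fun h _ _ hf => (hf.mono (inf_le_inf_right W (hk h))).postcomp _)
    (fun _ _ _ _ _ _ => Category.assoc _ _ _)

@[simp]
theorem app_ofHom {X Y : Sections W} (k : ∀ h, X.obj h ⟶ Y.obj h)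
    (hk : ∀ h, X.supp h ≤ Y.supp h) (h : (W : Set (ZI C)).Nonempty) {T : C} (f : T ⟶ X.obj h)
    (hf : Supp (X.supp h ⊓ W) f) : app (ofHom k hk) h f hf = f ≫ k h := rfl

/-- The isomorphism of sections given by an isomorphism of `C`. -/
@[simps]
def ofIso {X Y : Sections W} (k : ∀ h, X.obj h ≅ Y.obj h) (hk : ∀ h, X.supp h = Y.supp h) :
    X ≅ Y where
  hom := ofHom (fun h => (k h).hom) fun h => (hk h).le
  inv := ofHom (fun h => (k h).inv) fun h => (hk h).ge
  hom_inv_id := hom_ext fun h _ f _ => by simp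
  inv_hom_id := hom_ext fun h _ f _ => by simp

variable [hC : Fact (IsStiff C)]

/-- The tensor product of sections, on objects. -/
abbrev tensor (X Y : Sections W) : Sections W :=
  ⟨fun h => X.supp h ⊓ Y.supp h, fun h => X.obj h ⊗ Y.obj h⟩

/-- Both whiskerings come from this. The support in `K` is inherited from `f`, the one in `Y.supp h`
from the values of `φ`. -/
theorem exists_extension {X Y : Sections W} (φ : X ⟶ Y) {Φ : C ⥤ C} (hΦ : CommutesWithProj Φ)
    (h : (W : Set (ZI C)).Nonempty) {K : LowerSet (ZI C)} (hK : K ≤ X.supp h ⊓ W) {T : C}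
    (f : T ⟶ Φ.obj (X.obj h)) (hf : Supp K f) :
    ∃ g : T ⟶ Φ.obj (Y.obj h), Supp (Y.supp h ⊓ K) g ∧
      ∀ {S : C} (k : S ⟶ X.obj h) (hk : Supp (X.supp h ⊓ W) k) (l : T ⟶ Φ.obj S),
        l ≫ Φ.map k = f → g = l ≫ Φ.map (app φ h k hk) := by
  obtain ⟨g, hg, H⟩ := Supp.exists_extension hΦ (fun {_} f hf => app φ h f hf)
    (fun g f hf => app_comp_left φ h g f hf _) hK f hf
  refine ⟨g, Supp.inf ?_ hg, H⟩
  obtain ⟨u, hu, l, rfl⟩ := Supp.exists_eq_comp_map hΦ hf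
  rw [H _ (Supp.proj (hK hu) _) l rfl]
  exact (((supp_app φ h _ _).map hΦ).precomp _).mono inf_le_left

/-- Tensoring a morphism of sections on the right. -/
noncomputable def whiskerRight {X Y : Sections W} (φ : X ⟶ Y) (Z : Sections W) :
    tensor X Z ⟶ tensor Y Z :=
  -- Choosing a value below is harmless: the last clause determines it from any factorisation of `f`
  -- through a supported `k`.
  have H (h) {T : C} (f : T ⟶ (tensor X Z).obj h) (hf : Supp ((tensor X Z).supp h ⊓ W) f) :=
    exists_extension φ (commutesWithProj_tensorRight (Z.obj h)) h
      (inf_le_inf_right W inf_le_left) f hf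
  Hom.mk (fun h _ f hf => (H h f hf).choose)
    (fun h _ f hf => (H h f hf).choose_spec.1.mono
      (le_inf (le_inf inf_le_left (inf_le_right.trans (inf_le_left.trans inf_le_right)))
        (inf_le_right.trans inf_le_right)))
    (fun h _ _ g f hf => by
      obtain ⟨u, hu, l, rfl⟩ := Supp.exists_eq_comp_map (commutesWithProj_tensorRight (Z.obj h)) hf
      have hk := Supp.proj (J := X.supp h ⊓ W) ⟨hu.1.1, hu.2⟩ (X.obj h)
      rw [(H h _ hf).choose_spec.2 _ hk l rfl,
        (H h _ (hf.precomp g)).choose_spec.2 _ hk (g ≫ l) (Category.assoc _ _ _)]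
      exact Category.assoc _ _ _)

/-- Tensoring a morphism of sections on the left. -/
noncomputable def whiskerLeft (Z : Sections W) {X Y : Sections W} (φ : X ⟶ Y) :
    tensor Z X ⟶ tensor Z Y :=
  have H (h) {T : C} (f : T ⟶ (tensor Z X).obj h) (hf : Supp ((tensor Z X).supp h ⊓ W) f) :=
    exists_extension φ (commutesWithProj_tensorLeft (Z.obj h)) h
      (inf_le_inf_right W inf_le_right) f hf
  Hom.mk (fun h _ f hf => (H h f hf).choose)
    (fun h _ f hf => (H h f hf).choose_spec.1.mono
      (le_inf (le_inf (inf_le_right.trans (inf_le_left.trans inf_le_left)) inf_le_left)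
        (inf_le_right.trans inf_le_right)))
    (fun h _ _ g f hf => by
      obtain ⟨u, hu, l, rfl⟩ := Supp.exists_eq_comp_map (commutesWithProj_tensorLeft (Z.obj h)) hf
      have hk := Supp.proj (J := X.supp h ⊓ W) ⟨hu.1.2, hu.2⟩ (X.obj h)
      rw [(H h _ hf).choose_spec.2 _ hk l rfl,
        (H h _ (hf.precomp g)).choose_spec.2 _ hk (g ≫ l) (Category.assoc _ _ _)]
      exact Category.assoc _ _ _)

noncomputable instance : MonoidalCategoryStruct (Sections W) where
  tensorObj := tensor
  tensorUnit := ⟨fun _ => ⊤, fun _ => 𝟙_ C⟩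
  whiskerLeft := whiskerLeft
  whiskerRight := whiskerRight
  associator X Y Z := ofIso (X := tensor (tensor X Y) Z) (Y := tensor X (tensor Y Z))
    (fun h => α_ (X.obj h) (Y.obj h) (Z.obj h)) (fun _ => inf_assoc _ _ _)
  leftUnitor X := ofIso (X := tensor ⟨fun _ => ⊤, fun _ => 𝟙_ C⟩ X) (Y := X)
    (fun h => λ_ (X.obj h)) (fun _ => top_inf_eq _)
  rightUnitor X := ofIso (X := tensor X ⟨fun _ => ⊤, fun _ => 𝟙_ C⟩) (Y := X)
    (fun h => ρ_ (X.obj h)) (fun _ => inf_top_eq _)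
  tensorHom {_ _ _ _} φ ψ := whiskerRight φ _ ≫ whiskerLeft _ ψ

@[simp]
theorem tensor_obj (X Y : Sections W) (h : (W : Set (ZI C)).Nonempty) :
    (X ⊗ Y).obj h = X.obj h ⊗ Y.obj h := rfl

theorem app_whiskerRight {X Y : Sections W} (φ : X ⟶ Y) (Z : Sections W)
    (h : (W : Set (ZI C)).Nonempty) {S T : C} (l : T ⟶ S ⊗ Z.obj h) (k : S ⟶ X.obj h)
    (hk : Supp (X.supp h ⊓ W) k) (hf) :
    app (φ ▷ Z) h (l ≫ k ▷ Z.obj h) hf = l ≫ app φ h k hk ▷ Z.obj h :=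
  (exists_extension φ (commutesWithProj_tensorRight (Z.obj h)) h
      (inf_le_inf_right W inf_le_left) _ hf).choose_spec.2 k hk l rfl

theorem app_whiskerLeft {X Y : Sections W} (Z : Sections W) (φ : X ⟶ Y)
    (h : (W : Set (ZI C)).Nonempty) {S T : C} (l : T ⟶ Z.obj h ⊗ S) (k : S ⟶ X.obj h)
    (hk : Supp (X.supp h ⊓ W) k) (hf) :
    app (Z ◁ φ) h (l ≫ Z.obj h ◁ k) hf = l ≫ Z.obj h ◁ app φ h k hk :=
  (exists_extension φ (commutesWithProj_tensorLeft (Z.obj h)) h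
      (inf_le_inf_right W inf_le_right) _ hf).choose_spec.2 k hk l rfl

theorem app_tensorHom {X Y X' Y' : Sections W} (φ : X ⟶ Y) (ψ : X' ⟶ Y')
    (h : (W : Set (ZI C)).Nonempty) {S S' T : C} (l : T ⟶ S ⊗ S') (k : S ⟶ X.obj h)
    (hk : Supp (X.supp h ⊓ W) k) (k' : S' ⟶ X'.obj h) (hk' : Supp (X'.supp h ⊓ W) k') (hf) :
    app (φ ⊗ₘ ψ) h (l ≫ (k ⊗ₘ k')) hf = l ≫ (app φ h k hk ⊗ₘ app ψ h k' hk') := by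
  have e₁ : l ≫ (k ⊗ₘ k') = (l ≫ S ◁ k') ≫ k ▷ X'.obj h := by
    rw [MonoidalCategory.tensorHom_def', Category.assoc]
  have e₂ : (l ≫ S ◁ k') ≫ app φ h k hk ▷ X'.obj h =
      (l ≫ app φ h k hk ▷ S') ≫ Y.obj h ◁ k' := by
    rw [Category.assoc, Category.assoc, whisker_exchange]
  have e₃ : app (φ ▷ X') h (l ≫ (k ⊗ₘ k')) hf = (l ≫ app φ h k hk ▷ S') ≫ Y.obj h ◁ k' := by
    simp only [e₁]
    rw [app_whiskerRight φ X' h _ k hk, e₂]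
  change app (Y ◁ ψ) h (app (φ ▷ X') h (l ≫ (k ⊗ₘ k')) hf) (supp_app _ _ _ _) = _
  simp only [e₃]
  rw [app_whiskerLeft Y ψ h _ k' hk', MonoidalCategory.tensorHom_def, Category.assoc]

@[simp]
theorem app_associator_hom (X Y Z : Sections W) (h : (W : Set (ZI C)).Nonempty) {T : C}
    (f : T ⟶ ((X ⊗ Y) ⊗ Z).obj h) (hf) :
    app (α_ X Y Z).hom h f hf = f ≫ (α_ (X.obj h) (Y.obj h) (Z.obj h)).hom := rfl

@[simp]
theorem app_associator_inv (X Y Z : Sections W) (h : (W : Set (ZI C)).Nonempty) {T : C}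
    (f : T ⟶ (X ⊗ Y ⊗ Z).obj h) (hf) :
    app (α_ X Y Z).inv h f hf = f ≫ (α_ (X.obj h) (Y.obj h) (Z.obj h)).inv := rfl

@[simp]
theorem app_leftUnitor_hom (X : Sections W) (h : (W : Set (ZI C)).Nonempty) {T : C}
    (f : T ⟶ (𝟙_ (Sections W) ⊗ X).obj h) (hf) :
    app (λ_ X).hom h f hf = f ≫ (λ_ (X.obj h)).hom := rfl

@[simp]
theorem app_rightUnitor_hom (X : Sections W) (h : (W : Set (ZI C)).Nonempty) {T : C}
    (f : T ⟶ (X ⊗ 𝟙_ (Sections W)).obj h) (hf) :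
    app (ρ_ X).hom h f hf = f ≫ (ρ_ (X.obj h)).hom := rfl

/-- A supported morphism into a tensor product factors through a tensor product of two supported
morphisms, so by naturality these suffice as tests. -/
theorem hom_ext_tensor {X Y Z : Sections W} {φ ψ : X ⊗ Y ⟶ Z}
    (e : ∀ (h : (W : Set (ZI C)).Nonempty) {S S' : C} (k : S ⟶ X.obj h) (l : S' ⟶ Y.obj h)
      (_ : Supp (X.supp h ⊓ W) k) (_ : Supp (Y.supp h ⊓ W) l)
      (hf : Supp ((X ⊗ Y).supp h ⊓ W) (k ⊗ₘ l)), app φ h (k ⊗ₘ l) hf = app ψ h (k ⊗ₘ l) hf) :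
    φ = ψ := by
  refine hom_ext fun h T f hf => ?_
  obtain ⟨u, hu, g, rfl⟩ := Supp.exists_eq_comp_tensorHom hf
  have hX := Supp.proj (J := X.supp h ⊓ W) ⟨hu.1.1, hu.2⟩ (X.obj h)
  have hY := Supp.proj (J := Y.supp h ⊓ W) ⟨hu.1.2, hu.2⟩ (Y.obj h)
  have hXY : Supp ((X ⊗ Y).supp h ⊓ W) (u.proj (X.obj h) ⊗ₘ u.proj (Y.obj h)) :=
    (hX.tensorHom hY).mono
      (le_inf (inf_le_inf inf_le_left inf_le_left) (inf_le_left.trans inf_le_right))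
  rw [app_comp_left φ h _ _ hXY, app_comp_left ψ h _ _ hXY, e h _ _ hX hY]

theorem app_tensorHom_tensorHom {X Y X' Y' : Sections W} (φ : X ⟶ Y) (ψ : X' ⟶ Y')
    (h : (W : Set (ZI C)).Nonempty) {S S' : C} (k : S ⟶ X.obj h)
    (hk : Supp (X.supp h ⊓ W) k) (k' : S' ⟶ X'.obj h) (hk' : Supp (X'.supp h ⊓ W) k') (hf) :
    app (φ ⊗ₘ ψ) h (k ⊗ₘ k') hf = app φ h k hk ⊗ₘ app ψ h k' hk' := by
  have e := app_tensorHom φ ψ h (𝟙 _) k hk k' hk' (hf.precomp _)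
  simpa only [Category.id_comp] using e

theorem app_whiskerRight_tensorHom {X Y : Sections W} (φ : X ⟶ Y) (Z : Sections W)
    (h : (W : Set (ZI C)).Nonempty) {S S' : C} (k : S ⟶ X.obj h)
    (hk : Supp (X.supp h ⊓ W) k) (k' : S' ⟶ Z.obj h) (hf) :
    app (φ ▷ Z) h (k ⊗ₘ k') hf = app φ h k hk ⊗ₘ k' := by
  have e := app_whiskerRight φ Z h (S ◁ k') k hk
  simp only [MonoidalCategory.tensorHom_def'] at hf ⊢
  exact e _

theorem app_whiskerLeft_tensorHom {X Y : Sections W} (Z : Sections W) (φ : X ⟶ Y)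
    (h : (W : Set (ZI C)).Nonempty) {S S' : C} (k : S' ⟶ Z.obj h) (k' : S ⟶ X.obj h)
    (hk : Supp (X.supp h ⊓ W) k') (hf) :
    app (Z ◁ φ) h (k ⊗ₘ k') hf = k ⊗ₘ app φ h k' hk := by
  have e := app_whiskerLeft Z φ h (k ▷ S) k' hk
  simp only [MonoidalCategory.tensorHom_def] at hf ⊢
  exact e _

theorem hom_ext_tensor₃ {X Y Z P : Sections W} {φ ψ : (X ⊗ Y) ⊗ Z ⟶ P}
    (e : ∀ (h : (W : Set (ZI C)).Nonempty) {S S' S'' : C} (k : S ⟶ X.obj h) (l : S' ⟶ Y.obj h)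
      (m : S'' ⟶ Z.obj h) (_ : Supp (X.supp h ⊓ W) k) (_ : Supp (Y.supp h ⊓ W) l)
      (_ : Supp (Z.supp h ⊓ W) m) (hf : Supp (((X ⊗ Y) ⊗ Z).supp h ⊓ W) ((k ⊗ₘ l) ⊗ₘ m)),
      app φ h ((k ⊗ₘ l) ⊗ₘ m) hf = app ψ h ((k ⊗ₘ l) ⊗ₘ m) hf) :
    φ = ψ := by
  refine hom_ext_tensor fun h S S' k m hk hm hf => ?_
  obtain ⟨u, hu, g, rfl⟩ := Supp.exists_eq_comp_tensorHom hk
  have hX := Supp.proj (J := X.supp h ⊓ W) ⟨hu.1.1, hu.2⟩ (X.obj h)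
  have hY := Supp.proj (J := Y.supp h ⊓ W) ⟨hu.1.2, hu.2⟩ (Y.obj h)
  have hXYZ : Supp (((X ⊗ Y) ⊗ Z).supp h ⊓ W) ((u.proj (X.obj h) ⊗ₘ u.proj (Y.obj h)) ⊗ₘ m) :=
    ((hX.tensorHom hY).tensorHom hm).mono (le_inf (inf_le_inf (inf_le_inf inf_le_left inf_le_left)
      inf_le_left) (inf_le_left.trans (inf_le_left.trans inf_le_right)))
  have e' : (g ≫ (u.proj (X.obj h) ⊗ₘ u.proj (Y.obj h))) ⊗ₘ m =
      g ▷ S' ≫ ((u.proj (X.obj h) ⊗ₘ u.proj (Y.obj h)) ⊗ₘ m) := by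
    rw [← MonoidalCategory.tensorHom_id, tensorHom_comp_tensorHom, Category.id_comp]
  simp only [e']
  rw [app_comp_left φ h _ _ hXYZ, app_comp_left ψ h _ _ hXYZ, e h _ _ _ hX hY hm]

@[simp]
theorem app_whiskerLeft_ofHom (Z : Sections W) {X Y : Sections W} (k : ∀ h, X.obj h ⟶ Y.obj h)
    (hk : ∀ h, X.supp h ≤ Y.supp h) (h : (W : Set (ZI C)).Nonempty) {T : C}
    (f : T ⟶ (Z ⊗ X).obj h) (hf) :
    app (Z ◁ ofHom k hk) h f hf = f ≫ Z.obj h ◁ k h := by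
  obtain ⟨u, hu, g, rfl⟩ := Supp.exists_eq_comp_whiskerLeft hf
  have hX := Supp.proj (J := X.supp h ⊓ W) ⟨hu.1.2, hu.2⟩ (X.obj h)
  rw [app_whiskerLeft Z _ h g _ hX]
  simp

@[simp]
theorem app_whiskerRight_ofHom {X Y : Sections W} (k : ∀ h, X.obj h ⟶ Y.obj h)
    (hk : ∀ h, X.supp h ≤ Y.supp h) (Z : Sections W) (h : (W : Set (ZI C)).Nonempty) {T : C}
    (f : T ⟶ (X ⊗ Z).obj h) (hf) :
    app (ofHom k hk ▷ Z) h f hf = f ≫ k h ▷ Z.obj h := by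
  obtain ⟨u, hu, g, rfl⟩ := Supp.exists_eq_comp_whiskerRight hf
  have hX := Supp.proj (J := X.supp h ⊓ W) ⟨hu.1.1, hu.2⟩ (X.obj h)
  rw [app_whiskerRight _ Z h g _ hX]
  simp

theorem associator_hom_eq (X Y Z : Sections W) : (α_ X Y Z).hom =
    ofHom (fun h => (α_ (X.obj h) (Y.obj h) (Z.obj h)).hom) (fun _ => (inf_assoc _ _ _).le) := rfl

theorem leftUnitor_hom_eq (X : Sections W) : (λ_ X).hom =
    ofHom (fun h => (λ_ (X.obj h)).hom) (fun _ => (top_inf_eq _).le) := rfl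

theorem rightUnitor_hom_eq (X : Sections W) : (ρ_ X).hom =
    ofHom (fun h => (ρ_ (X.obj h)).hom) (fun _ => (inf_top_eq _).le) := rfl

/-- Tested on tensor products of supported morphisms, the axioms reduce to those of `C`; the
structure isomorphisms act by composition with those of `C`. -/
noncomputable instance : MonoidalCategory (Sections W) where
  tensorHom_def _ _ := rfl
  id_tensorHom_id X Y := hom_ext_tensor fun h S S' k l hk hl hf => by
    rw [app_tensorHom_tensorHom _ _ h k hk l hl, app_id, app_id, app_id]
  tensorHom_comp_tensorHom φ ψ φ' ψ' := hom_ext_tensor fun h S S' k l hk hl hf => by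
    rw [app_comp]
    simp only [app_tensorHom_tensorHom _ _ h k hk l hl, app_comp,
      app_tensorHom_tensorHom _ _ h _ (supp_app φ h k hk) _ (supp_app ψ h l hl)]
  whiskerLeft_id X Y := hom_ext_tensor fun h S S' k l hk hl hf => by
    rw [app_whiskerLeft_tensorHom _ _ h k l hl, app_id, app_id]
  id_whiskerRight X Y := hom_ext_tensor fun h S S' k l hk hl hf => by
    rw [app_whiskerRight_tensorHom _ _ h k hk l, app_id, app_id]
  associator_naturality {X Y Z _ _ _} φ ψ χ := hom_ext_tensor₃ fun h S S' S'' k l m hk hl hm _ => by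
    have hkl : Supp ((X ⊗ Y).supp h ⊓ W) (k ⊗ₘ l) :=
      (hk.tensorHom hl).mono
        (le_inf (inf_le_inf inf_le_left inf_le_left) (inf_le_left.trans inf_le_right))
    have hlm : Supp ((Y ⊗ Z).supp h ⊓ W) (l ⊗ₘ m) :=
      (hl.tensorHom hm).mono
        (le_inf (inf_le_inf inf_le_left inf_le_left) (inf_le_left.trans inf_le_right))
    simp only [app_comp, app_associator_hom, MonoidalCategory.associator_naturality]
    rw [app_tensorHom_tensorHom _ _ h _ hkl _ hm, app_tensorHom_tensorHom _ _ h _ hk _ hl,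
      app_tensorHom _ _ h _ _ hk _ hlm, app_tensorHom_tensorHom _ _ h _ hl _ hm,
      MonoidalCategory.associator_naturality]
  leftUnitor_naturality {X Y} φ := hom_ext fun h T f hf => by
    obtain ⟨u, hu, g, rfl⟩ := Supp.exists_eq_comp_whiskerLeft hf
    have hX := Supp.proj (J := X.supp h ⊓ W) ⟨hu.1.2, hu.2⟩ (X.obj h)
    have e : (g ≫ 𝟙_ C ◁ u.proj (X.obj h)) ≫ (λ_ (X.obj h)).hom =
        (g ≫ (λ_ _).hom) ≫ u.proj (X.obj h) := by
      rw [Category.assoc, Category.assoc, leftUnitor_naturality]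
    simp only [app_comp, app_leftUnitor_hom]
    rw [app_whiskerLeft _ _ h g _ hX]
    refine Eq.trans ?_ (Eq.symm (Eq.trans (by congr 1) (app_comp_left φ h (g ≫ (λ_ _).hom) _ hX
      (hX.precomp _))))
    rw [Category.assoc, Category.assoc, ← leftUnitor_naturality]
    rfl
  rightUnitor_naturality {X Y} φ := hom_ext fun h T f hf => by
    obtain ⟨u, hu, g, rfl⟩ := Supp.exists_eq_comp_whiskerRight hf
    have hX := Supp.proj (J := X.supp h ⊓ W) ⟨hu.1.1, hu.2⟩ (X.obj h)
    have e : (g ≫ u.proj (X.obj h) ▷ 𝟙_ C) ≫ (ρ_ (X.obj h)).hom =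
        (g ≫ (ρ_ _).hom) ≫ u.proj (X.obj h) := by
      rw [Category.assoc, Category.assoc, rightUnitor_naturality]
    simp only [app_comp, app_rightUnitor_hom]
    rw [app_whiskerRight _ _ h g _ hX]
    refine Eq.trans ?_ (Eq.symm (Eq.trans (by congr 1) (app_comp_left φ h (g ≫ (ρ_ _).hom) _ hX
      (hX.precomp _))))
    rw [Category.assoc, Category.assoc, ← rightUnitor_naturality]
    rfl
  pentagon X Y Z Z' := hom_ext fun h T f hf => by
    simp [associator_hom_eq]
  triangle X Y := hom_ext fun h T f hf => by
    simp only [app_comp, associator_hom_eq, leftUnitor_hom_eq, rightUnitor_hom_eq, app_ofHom,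
      app_whiskerLeft_ofHom, app_whiskerRight_ofHom, Category.assoc]
    exact congrArg (f ≫ ·) (MonoidalCategory.triangle (X.obj h) (Y.obj h))

end Sections

end Sections

/-! ### Restriction, and gluing of morphisms of sections -/

section Restriction

variable {C : Type*} [Category C] [MonoidalCategory C] [hC : Fact (IsStiff C)]

namespace Sections

variable {V W : LowerSet (ZI C)}

/-- Natural operations cannot enlarge supports: by naturality the value factors through a morphism
out of some `A ⊗ U` with `u` in `K`. This makes restriction to smaller open sets possible. -/
theorem supp_app_of_supp {X Y : Sections W} (φ : X ⟶ Y) (h : (W : Set (ZI C)).Nonempty) {T : C}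
    (f : T ⟶ X.obj h) (hf : Supp (X.supp h ⊓ W) f) {K : LowerSet (ZI C)} (hK : Supp K f) :
    Supp K (app φ h f hf) := by
  obtain ⟨u, hu, g, rfl⟩ := Supp.exists_eq_comp_proj (hf.inf hK)
  rw [app_comp_left φ h g _ (Supp.proj hu.1 _)]
  exact (Supp.of_dom hu.2 _).precomp g

/-- Restriction of sections to a smaller open set. -/
def restrict (hVW : V ≤ W) : Sections W ⥤ Sections V where
  obj X := ⟨fun h => X.supp (h.mono hVW), fun h => X.obj (h.mono hVW)⟩
  map {X Y} φ :=
    Hom.mk (fun h _ f hf => app φ (h.mono hVW) f (hf.mono (inf_le_inf_left _ hVW)))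
      (fun h _ f hf => ((supp_app φ _ f _).mono inf_le_left).inf
        (supp_app_of_supp φ _ f _ (hf.mono inf_le_right)))
      (fun h _ _ g f hf => app_comp_left φ (h.mono hVW) g f _ _)

theorem restrict_map_whiskerRight (hVW : V ≤ W) {X Y : Sections W} (φ : X ⟶ Y) (Z : Sections W) :
    (restrict hVW).map (φ ▷ Z) = (restrict hVW).map φ ▷ (restrict hVW).obj Z :=
  hom_ext_tensor (X := (restrict hVW).obj X) (Y := (restrict hVW).obj Z)
    fun h _ _ k l hk _ hf =>
      (app_whiskerRight_tensorHom φ Z (h.mono hVW) k (hk.mono (inf_le_inf_left _ hVW)) l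
        (hf.mono (inf_le_inf_left _ hVW))).trans
        (app_whiskerRight_tensorHom ((restrict hVW).map φ) ((restrict hVW).obj Z) h k hk l _).symm

theorem restrict_map_whiskerLeft (hVW : V ≤ W) {X Y : Sections W} (φ : X ⟶ Y) (Z : Sections W) :
    (restrict hVW).map (Z ◁ φ) = (restrict hVW).obj Z ◁ (restrict hVW).map φ :=
  hom_ext_tensor (X := (restrict hVW).obj Z) (Y := (restrict hVW).obj X)
    fun h _ _ k l _ hl hf =>
      (app_whiskerLeft_tensorHom Z φ (h.mono hVW) k l (hl.mono (inf_le_inf_left _ hVW))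
        (hf.mono (inf_le_inf_left _ hVW))).trans
        (app_whiskerLeft_tensorHom ((restrict hVW).obj Z) ((restrict hVW).map φ) h k l hl _).symm

/-- Restriction is strictly monoidal: it preserves unit and tensor product of objects on the nose.
-/
noncomputable instance (hVW : V ≤ W) : (restrict hVW).LaxMonoidal where
  ε := 𝟙 (𝟙_ (Sections V))
  μ X Y := 𝟙 ((restrict hVW).obj X ⊗ (restrict hVW).obj Y)
  μ_natural_left φ Z := (restrict_map_whiskerRight hVW φ Z).symm
  μ_natural_right Z φ := (restrict_map_whiskerLeft hVW φ Z).symm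
  associativity X Y Z :=
    (congrArg (· ≫ (α_ ((restrict hVW).obj X) ((restrict hVW).obj Y) ((restrict hVW).obj Z)).hom)
      (id_whiskerRight ((restrict hVW).obj X ⊗ (restrict hVW).obj Y) ((restrict hVW).obj Z))).trans
    (congrArg ((α_ ((restrict hVW).obj X) ((restrict hVW).obj Y) ((restrict hVW).obj Z)).hom ≫ ·)
      (whiskerLeft_id ((restrict hVW).obj X)
        ((restrict hVW).obj Y ⊗ (restrict hVW).obj Z))).symm
  left_unitality X := (congrArg (· ≫ (λ_ ((restrict hVW).obj X)).hom)
    (id_whiskerRight (𝟙_ (Sections V)) ((restrict hVW).obj X))).symm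
  right_unitality X := (congrArg (· ≫ (ρ_ ((restrict hVW).obj X)).hom)
    (whiskerLeft_id ((restrict hVW).obj X) (𝟙_ (Sections V)))).symm

section Gluing

variable {ι : Type*} {V : ι → LowerSet (ZI C)} (hVW : ∀ i, V i ≤ W)
  (hW : ∀ z ∈ W, ∃ i, z ∈ V i)

include hW

/-- The single central idempotent witnessing a support lies in some `V i`, where the two operations
agree. -/
theorem hom_ext_of_cover {X Y : Sections W} {φ ψ : X ⟶ Y}
    (e : ∀ i, (restrict (hVW i)).map φ = (restrict (hVW i)).map ψ) : φ = ψ := by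
  refine hom_ext fun h T f hf => ?_
  obtain ⟨u, hu, g, rfl⟩ := hf.exists_eq_comp_proj
  obtain ⟨i, hi⟩ := hW _ hu.2
  exact congrArg (fun φ => app φ ⟨_, hi⟩ (g ≫ u.proj (X.obj h))
    ((Supp.proj (J := X.supp h ⊓ V i) ⟨hu.1, hi⟩ _).precomp g)) (e i)

variable (hV : ∀ i j, ∃ k, V k = V i ⊓ V j)
include hV

/-- The value at `f` is read off in any `V i` in which `f` is supported. For two such sets,
`Supp.inf` supports `f` in their intersection, a member of the cover, where compatibility applies.
-/
theorem exists_hom_of_cover {X Y : Sections W}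
    (φ : ∀ i, (restrict (hVW i)).obj X ⟶ (restrict (hVW i)).obj Y)
    (hφ : ∀ i j (h : V i ≤ V j), (restrict h).map (φ j) = φ i) :
    ∃ ψ : X ⟶ Y, ∀ i, (restrict (hVW i)).map ψ = φ i := by
  have H (h) {T : C} (f : T ⟶ X.obj h) (hf : Supp (X.supp h ⊓ W) f) : ∃ g : T ⟶ Y.obj h,
      Supp (Y.supp h ⊓ W) g ∧ ∀ i (hi : (V i : Set (ZI C)).Nonempty)
        (hf' : Supp (X.supp h ⊓ V i) f), g = app (φ i) hi f hf' := by
    obtain ⟨u, hu, g, e⟩ := hf.exists_eq_comp_proj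
    obtain ⟨i, hi⟩ := hW _ hu.2
    have hfi : Supp (X.supp h ⊓ V i) f := ⟨u, ⟨hu.1, hi⟩, g, e.symm⟩
    refine ⟨app (φ i) ⟨_, hi⟩ f hfi, (supp_app (φ i) ⟨_, hi⟩ f hfi).mono
      (inf_le_inf_left _ (hVW i)), fun j hj hfj => ?_⟩
    obtain ⟨k, hk⟩ := hV i j
    have hfk : Supp (X.supp h ⊓ V k) f := by
      rw [hk]
      exact (hfi.inf hfj).mono (le_inf (inf_le_left.trans inf_le_left)
        (inf_le_inf inf_le_right inf_le_right))
    have hn : (V k : Set (ZI C)).Nonempty := by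
      obtain ⟨v, hv, -⟩ := id hfk
      exact ⟨_, hv.2⟩
    have e₁ := congrArg (fun φ => app φ hn f hfk) (hφ k i (hk.le.trans inf_le_left))
    have e₂ := congrArg (fun φ => app φ hn f hfk) (hφ k j (hk.le.trans inf_le_right))
    exact e₁.trans e₂.symm
  refine ⟨Hom.mk (fun h _ f hf => (H h f hf).choose) (fun h _ f hf => (H h f hf).choose_spec.1)
    (fun h S T g f hf => ?_), fun i => hom_ext fun h T f hf => ?_⟩
  · obtain ⟨u, hu, -⟩ := id hf
    obtain ⟨u, hu, l, e⟩ := hf.exists_eq_comp_proj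
    obtain ⟨i, hi⟩ := hW _ hu.2
    have hfi : Supp (X.supp h ⊓ V i) f := ⟨u, ⟨hu.1, hi⟩, l, e.symm⟩
    rw [(H h f hf).choose_spec.2 i ⟨_, hi⟩ hfi,
      (H h (g ≫ f) (hf.precomp g)).choose_spec.2 i ⟨_, hi⟩ (hfi.precomp g)]
    exact app_comp_left (φ i) ⟨_, hi⟩ g f hfi _
  · exact (H (h.mono (hVW i)) f (hf.mono (inf_le_inf_left _ (hVW i)))).choose_spec.2 i h hf

/-- Inverses are unique, so the local ones are compatible and glue. -/
theorem isIso_of_cover {X Y : Sections W} (φ : X ⟶ Y)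
    (h : ∀ i, IsIso ((restrict (hVW i)).map φ)) : IsIso φ := by
  choose χ hχ hχ' using fun i => (h i).out
  obtain ⟨ψ, hψ⟩ := exists_hom_of_cover hVW hW hV χ fun i j hij => by
    have e : (restrict hij).map (χ j) ≫ (restrict (hVW i)).map φ = 𝟙 _ :=
      congrArg (restrict hij).map (hχ' j)
    have H {A B : Sections (V i)} (f : A ⟶ B) (g g' : B ⟶ A) (h : g ≫ f = 𝟙 _)
        (h' : f ≫ g' = 𝟙 _) : g = g' := by
      rw [← Category.comp_id g, ← h', ← Category.assoc, h, Category.id_comp]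
    exact H _ _ _ e (hχ i)
  refine ⟨ψ, hom_ext_of_cover hVW hW fun i => ?_, hom_ext_of_cover hVW hW fun i => ?_⟩
  · refine ((restrict (hVW i)).map_comp φ ψ).trans ?_
    rw [hψ, hχ, CategoryTheory.Functor.map_id]
  · refine ((restrict (hVW i)).map_comp ψ φ).trans ?_
    rw [hψ, hχ', CategoryTheory.Functor.map_id]

end Gluing

end Sections

end Restriction

/-! ### Strict gluing of objects -/

section ObjectGluing

variable {C : Type*} [Category C] [MonoidalCategory C] [hC : Fact (IsStiff C)]

namespace Sections

variable {W : LowerSet (ZI C)} {ι : Type*} {V : ι → LowerSet (ZI C)} (hVW : ∀ i, V i ≤ W)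
  (hW : ∀ z ∈ W, ∃ i, z ∈ V i)

include hW

theorem obj_ext_of_cover {X Y : Sections W}
    (e : ∀ i, (restrict (hVW i)).obj X = (restrict (hVW i)).obj Y) : X = Y := by
  refine Sections.ext (funext fun h => ?_) (funext fun h => ?_)
  · obtain ⟨z, hz⟩ := id h
    obtain ⟨i, hi⟩ := hW z hz
    exact congrArg (fun X => supp X ⟨z, hi⟩) (e i)
  · obtain ⟨z, hz⟩ := id h
    obtain ⟨i, hi⟩ := hW z hz
    exact congrArg (fun X => obj X ⟨z, hi⟩) (e i)

/-- The space is irreducible: the tensor product of a point of `V i` and a point of `V j` lies in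
both. Hence all pairs given on nonempty members of the cover coincide. -/
theorem exists_obj_of_cover (hV : ∀ i j, ∃ k, V k = V i ⊓ V j) (o : ∀ i, Sections (V i))
    (ho : ∀ i j (h : V i ≤ V j), (restrict h).obj (o j) = o i) :
    ∃ X : Sections W, ∀ i, (restrict (hVW i)).obj X = o i := by
  have H (h : (W : Set (ZI C)).Nonempty) : ∃ x : LowerSet (ZI C) × C,
      ∀ i (hi : (V i : Set (ZI C)).Nonempty), x = ((o i).supp hi, (o i).obj hi) := by
    obtain ⟨z, hz⟩ := h
    obtain ⟨i, hi⟩ := hW z hz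
    refine ⟨((o i).supp ⟨z, hi⟩, (o i).obj ⟨z, hi⟩), fun j ⟨z', hj⟩ => ?_⟩
    obtain ⟨k, hk⟩ := hV i j
    obtain ⟨u, rfl⟩ := CentralIdempotent.exists_toZI_eq z
    obtain ⟨v, rfl⟩ := CentralIdempotent.exists_toZI_eq z'
    have hn : (V k : Set (ZI C)).Nonempty := by
      rw [hk]
      exact ⟨_, (V i).lower (u.toZI_tensor_le_left v) hi, (V j).lower (u.toZI_tensor_le_right v) hj⟩
    have e₁ := congrArg (fun X => (supp X hn, obj X hn)) (ho k i (hk.le.trans inf_le_left))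
    have e₂ := congrArg (fun X => (supp X hn, obj X hn)) (ho k j (hk.le.trans inf_le_right))
    exact e₁.trans e₂.symm
  refine ⟨⟨fun h => (H h).choose.1, fun h => (H h).choose.2⟩, fun i =>
    Sections.ext (funext fun h => ?_) (funext fun h => ?_)⟩
  · exact congrArg Prod.fst ((H (h.mono (hVW i))).choose_spec i h)
  · exact congrArg Prod.snd ((H (h.mono (hVW i))).choose_spec i h)

end Sections

end ObjectGluing

/-! ### Monoidal functors over a fixed map on objects -/

namespace MonCategory

/-- A morphism of small monoidal categories with prescribed action on objects. -/
structure HomOver (T D : MonCategory.{u}) (o : T → D) where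
  /-- the action on morphisms -/
  map : ∀ {s t : T}, (s ⟶ t) → (o s ⟶ o t)
  map_id : ∀ t : T, map (𝟙 t) = 𝟙 (o t)
  map_comp : ∀ {r s t : T} (f : r ⟶ s) (g : s ⟶ t), map (f ≫ g) = map f ≫ map g
  /-- the unit coherence -/
  ε : 𝟙_ D ⟶ o (𝟙_ T)
  /-- the tensor coherence -/
  μ : ∀ s t : T, o s ⊗ o t ⟶ o (s ⊗ t)
  μ_natural_left : ∀ {s t : T} (f : s ⟶ t) (r : T), map f ▷ o r ≫ μ t r = μ s r ≫ map (f ▷ r)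
  μ_natural_right : ∀ {s t : T} (r : T) (f : s ⟶ t), o r ◁ map f ≫ μ r t = μ r s ≫ map (r ◁ f)
  associativity : ∀ r s t : T, μ r s ▷ o t ≫ μ (r ⊗ s) t ≫ map (α_ r s t).hom =
    (α_ (o r) (o s) (o t)).hom ≫ o r ◁ μ s t ≫ μ r (s ⊗ t)
  left_unitality : ∀ t : T, (λ_ (o t)).hom = ε ▷ o t ≫ μ (𝟙_ T) t ≫ map (λ_ t).hom
  right_unitality : ∀ t : T, (ρ_ (o t)).hom = o t ◁ ε ≫ μ t (𝟙_ T) ≫ map (ρ_ t).hom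
  isIso_ε : IsIso ε

namespace HomOver

variable {T D E : MonCategory.{u}} {o : T → D}

@[ext]
theorem ext {a b : HomOver T D o} (h₁ : ∀ {s t : T} (f : s ⟶ t), a.map f = b.map f)
    (h₂ : a.ε = b.ε) (h₃ : ∀ s t, a.μ s t = b.μ s t) : a = b := by
  obtain ⟨ma, _, _, εa, μa, _⟩ := a
  obtain ⟨mb, _, _, εb, μb, _⟩ := b
  obtain rfl : @ma = @mb := by
    funext s t f
    exact h₁ f
  obtain rfl : εa = εb := h₂
  obtain rfl : μa = μb := by
    funext s t
    exact h₃ s t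
  rfl

/-- The underlying functor. -/
def functor (a : HomOver T D o) : T ⥤ D where
  obj := o
  map := a.map
  map_id := a.map_id
  map_comp := a.map_comp

instance (a : HomOver T D o) : a.functor.LaxMonoidal where
  ε := a.ε
  μ := a.μ
  μ_natural_left := a.μ_natural_left
  μ_natural_right := a.μ_natural_right
  associativity := a.associativity
  left_unitality := a.left_unitality
  right_unitality := a.right_unitality

/-- The underlying morphism of small monoidal categories. -/
def toHom (a : HomOver T D o) : T ⟶ D := Hom.mk a.functor (isIso_unit := a.isIso_ε)

/-- A morphism of small monoidal categories, viewed over its action on objects. -/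
def ofHom (F : T ⟶ D) : HomOver T D (toFunctor F).obj :=
  ⟨(toFunctor F).map, (toFunctor F).map_id, (toFunctor F).map_comp, F.lax.ε, F.lax.μ,
    F.lax.μ_natural_left, F.lax.μ_natural_right, F.lax.associativity, F.lax.left_unitality,
    F.lax.right_unitality, F.isIso_unit⟩

/-- Equality of objects is substituted once here, so that functors can later be compared and glued
without casts. -/
theorem exists_toHom_eq (F : T ⟶ D) (h : ∀ t, (toFunctor F).obj t = o t) :
    ∃ a : HomOver T D o, a.toHom = F := by
  obtain rfl : (toFunctor F).obj = o := funext h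
  exact ⟨ofHom F, rfl⟩

theorem toHom_injective : Function.Injective (toHom (o := o)) := by
  intro a b e
  -- For general `F` and `G` the two sides lie over different object maps; for `a` and `b` both maps
  -- are `o`.
  have key (F G : T ⟶ D) (e : F = G) : HEq (ofHom F) (ofHom G) := by rw [e]
  exact eq_of_heq (key _ _ e)

/-- Composition with a morphism of small monoidal categories. -/
def comp (a : HomOver T D o) (G : D ⟶ E) : HomOver T E (fun t => (toFunctor G).obj (o t)) :=
  ofHom (a.toHom ≫ G)

end HomOver

end MonCategory

open Topology

/-! ### The spectrum and its structure presheaf -/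

section Spectrum

variable (C : Type u) [SmallCategory C] [MonoidalCategory C]

/-- The spectrum of a small monoidal category: its central idempotents, with the lower sets as
open sets. -/
def spectrum : TopCat.{u} := TopCat.of (WithLowerSet (ZI C))

variable {C}

/-- An open set of the spectrum, as a lower set of central idempotents. -/
def opensToLowerSet (W : Opens (spectrum C)) : LowerSet (ZI C) := ⟨W.1, W.2⟩

theorem opensToLowerSet_mono {V W : Opens (spectrum C)} (h : V ≤ W) :
    opensToLowerSet V ≤ opensToLowerSet W := h

variable [hC : Fact (IsStiff C)]

/-- Restriction of sections, as a morphism of small monoidal categories. -/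
noncomputable def restrictHom {V W : LowerSet (ZI C)} (h : V ≤ W) :
    MonCategory.of (Sections W) ⟶ MonCategory.of (Sections V) :=
  MonCategory.Hom.mk (C := MonCategory.of (Sections W)) (D := MonCategory.of (Sections V))
    (Sections.restrict h)
    (isIso_unit := inferInstanceAs (IsIso (𝟙 (𝟙_ (Sections V)))))

variable (C)

/-- The structure sheaf on the spectrum. -/
noncomputable def structureSheaf : TopCat.Presheaf MonCategory.{u} (spectrum C) where
  obj W := MonCategory.of (Sections (opensToLowerSet W.unop))
  map f := restrictHom (opensToLowerSet_mono f.unop.le)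
  map_id _ := rfl
  map_comp _ _ := rfl

end Spectrum

theorem comp_congr {D : Type*} [Category D] {X Y Z : D} {f f' : X ⟶ Y} {g g' : Y ⟶ Z}
    (hf : f = f') (hg : g = g') : f ≫ g = f' ≫ g' := by rw [hf, hg]

/-! ### Gluing of monoidal functors into sections -/

section SheafCondition

variable {C : Type u} [SmallCategory C] [MonoidalCategory C] [hC : Fact (IsStiff C)]
  {T : MonCategory.{u}} {W : LowerSet (ZI C)} {ι : Type*} {V : ι → LowerSet (ZI C)}
  (hVW : ∀ i, V i ≤ W) (hW : ∀ z ∈ W, ∃ i, z ∈ V i)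

open MonCategory

include hW

theorem hom_eq_of_cover {F G : T ⟶ MonCategory.of (Sections W)}
    (e : ∀ i, F ≫ restrictHom (hVW i) = G ≫ restrictHom (hVW i)) : F = G := by
  have ho (t : T) : (toFunctor G).obj t = (toFunctor F).obj t :=
    Sections.obj_ext_of_cover hVW hW fun i => congrArg (fun H => (toFunctor H).obj t) (e i).symm
  obtain ⟨a, ha⟩ := HomOver.exists_toHom_eq (o := (toFunctor F).obj) F fun _ => rfl
  obtain ⟨b, rfl⟩ := HomOver.exists_toHom_eq (o := (toFunctor F).obj) G ho
  have key (i : ι) : a.comp (restrictHom (hVW i)) = b.comp (restrictHom (hVW i)) :=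
    HomOver.toHom_injective ((congrArg (· ≫ restrictHom (hVW i)) ha).trans (e i))
  refine ha.symm.trans (congrArg HomOver.toHom (HomOver.ext (fun f => ?_) ?_ fun s t => ?_))
  · exact Sections.hom_ext_of_cover hVW hW fun i => congrArg (fun c => c.map f) (key i)
  · exact Sections.hom_ext_of_cover hVW hW fun i => congrArg (fun c => c.ε) (key i)
  · exact Sections.hom_ext_of_cover hVW hW fun i => congrArg (fun c => c.μ s t) (key i)

/-- Objects are glued first, to fix the object map. Morphisms and coherences then glue one at a
time, and each axiom is an equation of morphisms of sections that holds on the cover. -/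
theorem exists_hom_glue (hV : ∀ i j, ∃ k, V k = V i ⊓ V j)
    (F : ∀ i, T ⟶ MonCategory.of (Sections (V i)))
    (hF : ∀ i j (h : V i ≤ V j), F j ≫ restrictHom h = F i) :
    ∃ G : T ⟶ MonCategory.of (Sections W), ∀ i, G ≫ restrictHom (hVW i) = F i := by
  have ho (t : T) := Sections.exists_obj_of_cover hVW hW hV (fun i => (toFunctor (F i)).obj t)
    fun i j h => congrArg (fun H => (toFunctor H).obj t) (hF i j h)
  choose o ho using ho
  choose a ha using fun i => HomOver.exists_toHom_eq
    (o := fun t => (Sections.restrict (hVW i)).obj (o t)) (F i) fun t => (ho t i).symm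
  have key (i j) (h : V i ≤ V j) : (a j).comp (restrictHom h) = a i :=
    HomOver.toHom_injective (((congrArg (· ≫ restrictHom h) (ha j)).trans (hF i j h)).trans
      (ha i).symm)
  have hmap {s t : T} (f : s ⟶ t) := Sections.exists_hom_of_cover hVW hW hV
    (fun i => (a i).map f) fun i j h => congrArg (fun c => c.map f) (key i j h)
  choose map hmap using @hmap
  obtain ⟨ε, hε⟩ := Sections.exists_hom_of_cover hVW hW hV (X := 𝟙_ (Sections W))
    (fun i => (a i).ε) fun i j h => congrArg (fun c => c.ε) (key i j h)
  have hμ (s t : T) := Sections.exists_hom_of_cover hVW hW hV (X := o s ⊗ o t)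
    (fun i => (a i).μ s t) fun i j h => congrArg (fun c => c.μ s t) (key i j h)
  choose μ hμ using hμ
  have hR (i) {X Y : Sections W} (φ : X ⟶ Y) (Z : Sections W)
      {ψ : (Sections.restrict (hVW i)).obj X ⟶ (Sections.restrict (hVW i)).obj Y}
      (h : (Sections.restrict (hVW i)).map φ = ψ) :
      (Sections.restrict (hVW i)).map (φ ▷ Z) = ψ ▷ (Sections.restrict (hVW i)).obj Z :=
    h ▸ Sections.restrict_map_whiskerRight (hVW i) φ Z
  have hL (i) {X Y : Sections W} (φ : X ⟶ Y) (Z : Sections W)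
      {ψ : (Sections.restrict (hVW i)).obj X ⟶ (Sections.restrict (hVW i)).obj Y}
      (h : (Sections.restrict (hVW i)).map φ = ψ) :
      (Sections.restrict (hVW i)).map (Z ◁ φ) = (Sections.restrict (hVW i)).obj Z ◁ ψ :=
    h ▸ Sections.restrict_map_whiskerLeft (hVW i) φ Z
  let b : HomOver T (MonCategory.of (Sections W)) o :=
    { map := map
      map_id t := Sections.hom_ext_of_cover hVW hW fun i => (hmap (𝟙 t) i).trans ((a i).map_id t)
      map_comp f g := Sections.hom_ext_of_cover hVW hW fun i => (hmap (f ≫ g) i).trans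
        (((a i).map_comp f g).trans (comp_congr (hmap f i).symm (hmap g i).symm))
      ε := ε
      μ := μ
      μ_natural_left {s t} f r := Sections.hom_ext_of_cover hVW hW fun i =>
        (comp_congr (hR i (map f) (o r) (hmap f i)) (hμ t r i)).trans
          (((a i).μ_natural_left f r).trans
            (comp_congr (hμ s r i).symm (hmap (f ▷ r) i).symm))
      μ_natural_right {s t} r f := Sections.hom_ext_of_cover hVW hW fun i =>
        (comp_congr (hL i (map f) (o r) (hmap f i)) (hμ r t i)).trans
          (((a i).μ_natural_right r f).trans
            (comp_congr (hμ r s i).symm (hmap (r ◁ f) i).symm))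
      associativity r s t := Sections.hom_ext_of_cover hVW hW fun i =>
        (comp_congr (hR i (μ r s) (o t) (hμ r s i))
          (comp_congr (hμ (r ⊗ s) t i) (hmap (α_ r s t).hom i))).trans
          (((a i).associativity r s t).trans
            (comp_congr rfl (comp_congr (hL i (μ s t) (o r) (hμ s t i)).symm
              (hμ r (s ⊗ t) i).symm)))
      left_unitality t := Sections.hom_ext_of_cover hVW hW fun i =>
        ((a i).left_unitality t).trans (comp_congr (hR i ε (o t) (hε i)).symm
          (comp_congr (hμ (𝟙_ T) t i).symm (hmap (λ_ t).hom i).symm))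
      right_unitality t := Sections.hom_ext_of_cover hVW hW fun i =>
        ((a i).right_unitality t).trans (comp_congr (hL i ε (o t) (hε i)).symm
          (comp_congr (hμ t (𝟙_ T) i).symm (hmap (ρ_ t).hom i).symm))
      -- Invertibility of the unit coherence is not an equation, but it too can be checked on the
      -- cover.
      isIso_ε := Sections.isIso_of_cover hVW hW hV _ fun i => by
        rw [hε]
        exact (a i).isIso_ε }
  refine ⟨b.toHom, fun i => ?_⟩
  rw [← ha i]
  change (b.comp (restrictHom (hVW i))).toHom = _
  congr 1
  refine HomOver.ext (fun f => hmap f i) ?_ fun s t => ?_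
  · exact hε i
  · exact hμ s t i

end SheafCondition

/-! ### The sheaf property and the stalks -/

section Stalks

variable (C : Type u) [SmallCategory C] [MonoidalCategory C] [hC : Fact (IsStiff C)]

theorem structureSheaf_isSheaf : (structureSheaf C).IsSheaf := by
  intro T W S hS x hx
  -- All members of the sieve are used as the cover, so it is closed under binary intersections.
  let ι := { V : Opens (spectrum C) // ∃ h : V ≤ W, S.arrows (homOfLE h) }
  let V : ι → LowerSet (ZI C) := fun i => opensToLowerSet i.1
  have hVW (i : ι) : V i ≤ opensToLowerSet W := i.2.choose
  have hW : ∀ z ∈ opensToLowerSet W, ∃ i, z ∈ V i := fun z hz => by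
    obtain ⟨V, f, hf, hz⟩ := hS z hz
    exact ⟨⟨V, f.le, hf⟩, hz⟩
  have hV : ∀ i j, ∃ k, V k = V i ⊓ V j := fun i j =>
    ⟨⟨i.1 ⊓ j.1, inf_le_left.trans i.2.choose,
      S.downward_closed i.2.choose_spec (homOfLE inf_le_left)⟩, rfl⟩
  let F (i : ι) : T ⟶ MonCategory.of (Sections (V i)) := x _ i.2.choose_spec
  have hF (i j) (h : V i ≤ V j) : F j ≫ restrictHom h = F i :=
    (hx.to_sieveCompatible _ (homOfLE (show i.1 ≤ j.1 from h)) j.2.choose_spec).symm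
  obtain ⟨G, hG⟩ := exists_hom_glue hVW hW hV F hF
  refine ⟨G, fun U f hf => hG ⟨U, f.le, hf⟩, fun G' hG' => ?_⟩
  exact hom_eq_of_cover hVW hW fun i => (hG' _ i.2.choose_spec).trans (hG i).symm

/-- The least open neighbourhood of a point of the spectrum. -/
def leastOpen (z : spectrum C) : OpenNhds z :=
  ⟨⟨(LowerSet.Iic (WithLowerSet.ofLowerSet (α := ZI C) z) : Set (ZI C)), (LowerSet.Iic _).lower⟩,
    le_refl (WithLowerSet.ofLowerSet (α := ZI C) z)⟩

/-- The least open neighbourhood is initial among open neighbourhoods. -/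
def isInitialLeastOpen (z : spectrum C) : Limits.IsInitial (leastOpen C z) :=
  Limits.IsInitial.ofUniqueHom (fun U => homOfLE fun _ (hx : _ ∈ LowerSet.Iic (α := ZI C) z) =>
      (opensToLowerSet U.1).lower hx U.2)
    fun _ _ => Subsingleton.elim _ _

/-- The least neighbourhood `↓z` is terminal in the opposite of the neighbourhoods, so the stalk at
`z` is the value there. -/
theorem isSheafOf_structureSheaf (P : MonCategory.{u} → Prop)
    (hP : ∀ z : ZI C, P (MonCategory.of (Sections (LowerSet.Iic z)))) :
    IsSheafOf P (structureSheaf C) :=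
  ⟨structureSheaf_isSheaf C, fun z => ⟨_, ⟨Limits.colimitOfDiagramTerminal
    (Limits.terminalOpOfInitial (isInitialLeastOpen C z)) _⟩,
      hP (WithLowerSet.ofLowerSet (α := ZI C) z)⟩⟩

end Stalks

/-! ### A criterion for locality -/

section Criterion

variable {D : Type*} [Category D] [MonoidalCategory D]

namespace CentralIdempotent

theorem toZI_eq_top_iff (u : CentralIdempotent D) : u.toZI = ⊤ ↔ IsIso u.mor := by
  constructor
  · intro h
    obtain ⟨m, hm⟩ := Quotient.exact h
    have : IsIso u.hom := by
      have hm' : m.hom = u.hom := (Category.comp_id _).symm.trans hm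
      exact hm' ▸ m.isIso_hom
    exact inferInstanceAs (IsIso ((Center.forget D).map u.hom))
  · intro (h : IsIso u.hom.f)
    have := Center.isIso_of_f_isIso u.hom
    let e : u.obj ≅ 𝟙_ (Center D) := asIso u.hom
    exact Quotient.sound ⟨e, Category.comp_id _⟩

/-- A factorisation in the underlying category automatically respects the half-braidings: both
composites agree after the monomorphism `A ◁ v.mor`. -/
theorem toZI_le_of_factor {u v : CentralIdempotent D} [∀ A : D, Mono (A ◁ v.mor)]
    (k : u.dom ⟶ v.dom) (hk : k ≫ v.mor = u.mor) : u.toZI ≤ v.toZI := by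
  refine toZI_le_toZI.2 ⟨⟨k, fun A => ?_⟩, Center.ext _ _ hk⟩
  have hu : u.mor ▷ A ≫ (λ_ A).hom ≫ (ρ_ A).inv = (u.braid A).hom ≫ A ◁ u.mor :=
    u.hom.comm A
  have hv : v.mor ▷ A ≫ (λ_ A).hom ≫ (ρ_ A).inv = (v.braid A).hom ≫ A ◁ v.mor :=
    v.hom.comm A
  change k ▷ A ≫ (v.braid A).hom = (u.braid A).hom ≫ A ◁ k
  rw [← cancel_mono (A ◁ v.mor), Category.assoc, Category.assoc, ← hv,
    ← MonoidalCategory.whiskerLeft_comp, hk, ← hu, ← comp_whiskerRight_assoc, hk]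

end CentralIdempotent

/-- Here `m` represents the largest element other than `1`, so a family avoiding `1` is bounded by
`m` and cannot have join `1`. -/
theorem isBigveeLocalOrder_of_forall (m : CentralIdempotent D) [∀ A : D, Mono (A ◁ m.mor)]
    (hm : ¬ IsIso m.mor) (h : ∀ w : CentralIdempotent D,
      IsIso w.mor ∨ ∃ k : w.dom ⟶ m.dom, k ≫ m.mor = w.mor) :
    IsBigveeLocalOrder (ZI D) := by
  rw [← m.toZI_eq_top_iff] at hm
  refine ⟨⟨_, _, hm⟩, fun S hS => ?_⟩
  by_contra hT
  refine hm (top_le_iff.1 (hS.2 fun z hz => ?_))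
  obtain ⟨w, rfl⟩ := CentralIdempotent.exists_toZI_eq z
  rcases h w with hw | ⟨k, hk⟩
  · exact absurd (w.toZI_eq_top_iff.2 hw ▸ hz) hT
  · exact CentralIdempotent.toZI_le_of_factor k hk

theorem IsBigveeLocalOrder.isVeeLocalOrder {P : Type*} [PartialOrder P] [OrderTop P]
    (h : IsBigveeLocalOrder P) : IsVeeLocalOrder P :=
  ⟨h.1, fun u w huw => by
    rcases h.2 _ huw with h | h
    · exact Or.inl h.symm
    · exact Or.inr (Eq.symm h)⟩

end Criterion

/-! ### Half-braidings and central idempotents of sections -/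

section Lift

variable {C : Type*} [Category C] [MonoidalCategory C] [hC : Fact (IsStiff C)]

namespace Sections

variable {W : LowerSet (ZI C)}

/-- A half-braiding in `C` induces half-braidings on sections. -/
noncomputable def liftHalfBraiding (J : LowerSet (ZI C)) {U : C} (b : HalfBraiding U) :
    HalfBraiding (⟨fun _ => J, fun _ => U⟩ : Sections W) where
  β X := ofIso (fun h => b.β (X.obj h)) (fun _ => inf_comm _ _)
  monoidal X Y := hom_ext fun h T f hf => by
    simp only [ofIso_hom, app_ofHom, app_comp, app_whiskerLeft_ofHom, app_whiskerRight_ofHom,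
      app_associator_hom, app_associator_inv, tensor_obj, b.monoidal, Category.assoc]
  naturality {X Y} φ := hom_ext fun h T f hf => by
    obtain ⟨u, hu, g, rfl⟩ := Supp.exists_eq_comp_whiskerLeft hf
    have hX := Supp.proj (J := X.supp h ⊓ W) ⟨hu.1.2, hu.2⟩ (X.obj h)
    have e : (g ≫ U ◁ u.proj (X.obj h)) ≫ (b.β (X.obj h)).hom =
        (g ≫ (b.β _).hom) ≫ u.proj (X.obj h) ▷ U := by
      rw [Category.assoc, b.naturality, Category.assoc]
    simp only [app_comp, ofIso_hom, app_ofHom, e]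
    rw [app_whiskerLeft _ _ h g _ hX, app_whiskerRight _ _ h _ _ hX, Category.assoc,
      Category.assoc, b.naturality]

/-- The object of sections corresponding to a lower set of central idempotents. -/
abbrev idealObj (J : LowerSet (ZI C)) : Sections W := ⟨fun _ => J, fun _ => 𝟙_ C⟩

/-- The inclusion of a lower set of central idempotents into the tensor unit. -/
noncomputable def idealInclusion (J : LowerSet (ZI C)) :
    idealObj J ⟶ 𝟙_ (Sections W) :=
  ofHom (fun _ => 𝟙 (𝟙_ C)) fun _ => le_top

@[simp]
theorem app_idealInclusion (J : LowerSet (ZI C)) (h : (W : Set (ZI C)).Nonempty) {T : C}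
    (f : T ⟶ 𝟙_ C) (hf) : app (idealInclusion J) h f hf = f := Category.comp_id f

/-- Inclusions of ideals change supports only. This makes them monic after tensoring and reduces the
axioms for `ideal` to those of the unit of `C`. -/
theorem app_whiskerLeft_idealInclusion (J : LowerSet (ZI C)) (A : Sections W)
    (h : (W : Set (ZI C)).Nonempty) {T : C} (f : T ⟶ A.obj h ⊗ 𝟙_ C) (hf) :
    app (A ◁ idealInclusion J) h f hf = f := by
  refine (app_whiskerLeft_ofHom A (X := idealObj J) (Y := 𝟙_ (Sections W))
    (fun _ => 𝟙 (𝟙_ C)) (fun _ => le_top) h f hf).trans ?_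
  rw [MonoidalCategory.whiskerLeft_id]
  exact Category.comp_id f

theorem app_whiskerRight_idealInclusion (J : LowerSet (ZI C)) (A : Sections W)
    (h : (W : Set (ZI C)).Nonempty) {T : C} (f : T ⟶ 𝟙_ C ⊗ A.obj h) (hf) :
    app (idealInclusion J ▷ A) h f hf = f := by
  refine (app_whiskerRight_ofHom (X := idealObj J) (Y := 𝟙_ (Sections W))
    (fun _ => 𝟙 (𝟙_ C)) (fun _ => le_top) A h f hf).trans ?_
  rw [MonoidalCategory.id_whiskerRight]
  exact Category.comp_id f

instance mono_whiskerLeft_idealInclusion (J : LowerSet (ZI C)) (A : Sections W) :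
    Mono (A ◁ idealInclusion J) where
  right_cancellation φ ψ e := hom_ext fun h T f hf => by
    have := congrArg (fun φ => app φ h f hf) e
    exact (app_whiskerLeft_idealInclusion J A h (app φ h f hf) (supp_app _ _ _ _)).symm.trans
      (this.trans (app_whiskerLeft_idealInclusion J A h (app ψ h f hf) (supp_app _ _ _ _)))

/-- The central idempotent of sections corresponding to a lower set of central idempotents. -/
noncomputable def ideal (J : LowerSet (ZI C)) : CentralIdempotent (Sections W) where
  obj := ⟨idealObj J, liftHalfBraiding J (𝟙_ (Center C)).2⟩
  hom := ⟨idealInclusion J, fun X => hom_ext fun h T f hf =>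
    (congrArg (fun g => (g ≫ (λ_ (X.obj h)).hom) ≫ (ρ_ (X.obj h)).inv)
      (app_whiskerRight_idealInclusion J X h f hf)).trans ((Category.assoc _ _ _).trans
      (app_whiskerLeft_idealInclusion J X h (f ≫ (λ_ (X.obj h)).hom ≫ (ρ_ (X.obj h)).inv)
        (supp_app ((liftHalfBraiding J (𝟙_ (Center C)).2).β X).hom h f hf)).symm)⟩
  central := Center.ext _ _ (hom_ext fun h T f hf =>
    (congrArg (· ≫ (λ_ (𝟙_ C)).hom) (app_whiskerRight_idealInclusion J _ h f hf)).trans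
      ((congrArg (f ≫ ·) unitors_equal).trans
        (congrArg (· ≫ (ρ_ (𝟙_ C)).hom) (app_whiskerLeft_idealInclusion J _ h f hf)).symm))
  isIso := by
    -- Idempotence amounts to `J ⊓ J = J`.
    have e : idealInclusion (W := W) J ▷ idealObj J ≫ (λ_ (idealObj J)).hom =
        (ofIso (X := idealObj J ⊗ idealObj J) (Y := idealObj J) (fun _ => λ_ (𝟙_ C))
          (fun _ => inf_idem J)).hom :=
      hom_ext fun h T f hf =>
        congrArg (· ≫ (λ_ (𝟙_ C)).hom) (app_whiskerRight_idealInclusion J _ h f hf)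
    have h : IsIso (idealInclusion (W := W) J ▷ idealObj J ≫ (λ_ (idealObj J)).hom) := by
      rw [e]
      infer_instance
    exact @Center.isIso_of_f_isIso _ _ _ _ _ _ h

instance mono_whiskerLeft_ideal_mor (J : LowerSet (ZI C)) (A : Sections W) :
    Mono (A ◁ (ideal J).mor) := mono_whiskerLeft_idealInclusion J A

end Sections

end Lift

/-! ### Descent of half-braidings from sections over `↓u` to `C` -/

section Stalk

variable {C : Type*} [Category C] [MonoidalCategory C]

/-- Every `v ≤ u` factors through `u`, so over `↓u` all supports can be witnessed by `u` itself.
This makes `u.proj` a generic supported morphism there. -/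
theorem Supp.exists_eq_of_Iic {Φ : C ⥤ C} (hΦ : CommutesWithProj Φ) (u : CentralIdempotent C)
    {A T : C} {f : T ⟶ Φ.obj A} (hf : Supp (LowerSet.Iic u.toZI) f) :
    ∃ g : T ⟶ Φ.obj (A ⊗ u.dom), g ≫ Φ.map (u.proj A) = f := by
  obtain ⟨v, hv, g, rfl⟩ := hf.exists_eq_comp_map hΦ
  obtain ⟨m, hm⟩ := CentralIdempotent.toZI_le_toZI.1 hv
  exact ⟨g ≫ Φ.map (A ◁ m.f), by
    rw [Category.assoc, ← Φ.map_comp, v.whiskerLeft_proj u m hm]⟩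

namespace Sections

theorem app_congr {W : LowerSet (ZI C)} {X Y : Sections W} (φ : X ⟶ Y)
    (h : (W : Set (ZI C)).Nonempty) {T : C} {f f' : T ⟶ X.obj h} (e : f = f')
    (hf : Supp (X.supp h ⊓ W) f) (hf' : Supp (X.supp h ⊓ W) f') :
    app φ h f hf = app φ h f' hf' := by
  subst e
  rfl

theorem app_hom_congr {W : LowerSet (ZI C)} {X Y : Sections W} {φ ψ : X ⟶ Y} (e : φ = ψ)
    (h : (W : Set (ZI C)).Nonempty) {T : C} (f : T ⟶ X.obj h) (hf : Supp (X.supp h ⊓ W) f) :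
    app φ h f hf = app ψ h f hf := by rw [e]

/-- An object of `C`, as a section. -/
abbrev const {W : LowerSet (ZI C)} (B : C) : Sections W := ⟨fun _ => ⊤, fun _ => B⟩

section Descent

variable [hC : Fact (IsStiff C)]

variable {u : CentralIdempotent C} {X : Sections (LowerSet.Iic u.toZI)}
  (h : (LowerSet.Iic u.toZI : Set (ZI C)).Nonempty)

theorem supp_proj_whiskerRight (hX : u.toZI ∈ X.supp h) (B : C) :
    Supp ((X ⊗ const B).supp h ⊓ LowerSet.Iic u.toZI) (u.proj (X.obj h) ▷ B) :=
  (Supp.proj (J := (X.supp h ⊓ ⊤) ⊓ LowerSet.Iic u.toZI)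
    ⟨⟨hX, trivial⟩, LowerSet.mem_Iic_iff.2 le_rfl⟩ (X.obj h)).whiskerRight B

theorem supp_whiskerLeft_proj (hX : u.toZI ∈ X.supp h) (B : C) :
    Supp ((const B ⊗ X).supp h ⊓ LowerSet.Iic u.toZI) (B ◁ u.proj (X.obj h)) :=
  (Supp.proj (J := (⊤ ⊓ X.supp h) ⊓ LowerSet.Iic u.toZI)
    ⟨⟨trivial, hX⟩, LowerSet.mem_Iic_iff.2 le_rfl⟩ (X.obj h)).whiskerLeft B

/-- The half-braiding on `A ⊗ U` induced by a half-braiding on a section over `↓u`. -/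
noncomputable def descentHom (b : HalfBraiding X) (hX : u.toZI ∈ X.supp h) (B : C) :
    (X.obj h ⊗ u.dom) ⊗ B ⟶ B ⊗ (X.obj h ⊗ u.dom) :=
  (Supp.exists_eq_of_Iic (commutesWithProj_tensorLeft B) u
    ((supp_app (b.β (const B)).hom h _ (supp_proj_whiskerRight h hX B)).mono inf_le_right)).choose

theorem descentHom_proj (b : HalfBraiding X) (hX : u.toZI ∈ X.supp h) (B : C) (hf) :
    descentHom h b hX B ≫ B ◁ u.proj (X.obj h) =
      app (b.β (const B)).hom h (u.proj (X.obj h) ▷ B) hf :=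
  (Supp.exists_eq_of_Iic (commutesWithProj_tensorLeft B) u
    ((supp_app (b.β (const B)).hom h _ (supp_proj_whiskerRight h hX B)).mono
      inf_le_right)).choose_spec

theorem exists_descent_inv (b : HalfBraiding X) (hX : u.toZI ∈ X.supp h) (B : C) :
    ∃ τ : B ⊗ (X.obj h ⊗ u.dom) ⟶ (X.obj h ⊗ u.dom) ⊗ B,
      τ ≫ u.proj (X.obj h) ▷ B = app (b.β (const B)).inv h (B ◁ u.proj (X.obj h))
        (supp_whiskerLeft_proj h hX B) :=
  Supp.exists_eq_of_Iic (commutesWithProj_tensorRight B) u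
    ((supp_app (b.β (const B)).inv h _ (supp_whiskerLeft_proj h hX B)).mono inf_le_right)

/-- The two sections differ only in their supports, `⊤` and `⊤ ⊓ ⊤`; naturality of `b` along the
comparison `ι` bridges them. -/
theorem app_halfBraiding_tensor (b : HalfBraiding X) (B B' : C) {T : C}
    (f : T ⟶ X.obj h ⊗ (B ⊗ B')) (hf) (hf') :
    app (b.β (const (B ⊗ B'))).hom h f hf = app (b.β (const B ⊗ const B')).hom h f hf' := by
  let ι : (const B ⊗ const B' : Sections (LowerSet.Iic u.toZI)) ⟶ const (B ⊗ B') :=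
    ofHom (fun _ => 𝟙 (B ⊗ B')) fun _ => le_top
  have e := app_hom_congr (b.naturality ι) h f hf'
  rw [app_comp, app_comp] at e
  have e₁ : app (X ◁ ι) h f hf' = f := by
    refine (app_whiskerLeft_ofHom X (X := const B ⊗ const B') (Y := const (B ⊗ B'))
      (fun _ => 𝟙 (B ⊗ B')) (fun _ => le_top) h f hf').trans ?_
    exact (congrArg (f ≫ ·) (whiskerLeft_id (X.obj h) (B ⊗ B'))).trans (Category.comp_id f)
  refine (app_congr _ h e₁.symm hf (supp_app _ _ _ _)).trans (e.trans ?_)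
  refine (app_whiskerRight_ofHom (X := const B ⊗ const B') (Y := const (B ⊗ B'))
      (fun _ => 𝟙 (B ⊗ B')) (fun _ => le_top) X h _ _).trans ?_
  exact (congrArg (_ ≫ ·) (id_whiskerRight (B ⊗ B') (X.obj h))).trans (Category.comp_id _)

/-- A half-braiding on a section over `↓u` induces one on the tensor product with `U` in `C`. -/
noncomputable def descentHalfBraiding (b : HalfBraiding X) (hX : u.toZI ∈ X.supp h) :
    HalfBraiding (X.obj h ⊗ u.dom) where
  β B :=
    { hom := descentHom h b hX B
      inv := (exists_descent_inv h b hX B).choose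
      hom_inv_id := by
        have hσ := descentHom_proj h b hX B (supp_proj_whiskerRight h hX B)
        have hτ := (exists_descent_inv h b hX B).choose_spec
        -- After composing with this monomorphism the claim becomes invertibility of `b`, evaluated
        -- at `u.proj`.
        rw [← cancel_mono (u.proj (X.obj h) ▷ B), Category.assoc, hτ, Category.id_comp,
          ← app_comp_left _ h _ _ _ ((supp_whiskerLeft_proj h hX B).precomp _)]
        refine (app_congr _ h hσ _ (supp_app _ _ _ _)).trans ?_
        rw [← app_comp]
        exact app_hom_congr (b.β (const B)).hom_inv_id h _ _
      inv_hom_id := by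
        have hσ := descentHom_proj h b hX B (supp_proj_whiskerRight h hX B)
        have hτ := (exists_descent_inv h b hX B).choose_spec
        rw [← cancel_mono (B ◁ u.proj (X.obj h)), Category.assoc, hσ, Category.id_comp,
          ← app_comp_left _ h _ _ _ ((supp_proj_whiskerRight h hX B).precomp _)]
        refine (app_congr _ h hτ _ (supp_app _ _ _ _)).trans ?_
        rw [← app_comp]
        exact app_hom_congr (b.β (const B)).inv_hom_id h _ _ }
  monoidal B B' := by
    have hp := supp_proj_whiskerRight (X := X) h hX (B ⊗ B')
    have hp' : Supp ((X ⊗ const B ⊗ const B').supp h ⊓ LowerSet.Iic u.toZI)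
        (u.proj (X.obj h) ▷ (B ⊗ B')) :=
      hp.mono (inf_le_inf_right _ (inf_le_inf_left _ (le_inf le_rfl le_rfl)))
    dsimp only
    rw [← cancel_mono ((B ⊗ B') ◁ u.proj (X.obj h)), descentHom_proj h b hX _ hp,
      app_halfBraiding_tensor h b B B' _ hp hp',
      app_hom_congr (b.monoidal (const B) (const B')) h _ hp']
    -- `E₁` and `E₂` evaluate the two braidings of the hexagon for `b` successively, starting from
    -- `u.proj`.
    have E₁ (hf) : app ((b.β (const B)).hom ▷ const B') h
        (u.proj (X.obj h) ▷ (B ⊗ B') ≫ (α_ _ _ _).inv) hf =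
        (α_ _ _ _).inv ≫ (descentHom h b hX B ≫ B ◁ u.proj (X.obj h)) ▷ B' := by
      rw [descentHom_proj h b hX B (supp_proj_whiskerRight h hX B)]
      have e := MonoidalCategory.associator_inv_naturality_left (u.proj (X.obj h)) B B'
      refine (app_congr _ h e hf (e ▸ hf)).trans (app_whiskerRight _ (const B') h _ _
        (supp_proj_whiskerRight h hX B) (e ▸ hf))
    have E₂ (hf) : app (const B ◁ (b.β (const B')).hom) h
        (((α_ _ _ _).inv ≫ (descentHom h b hX B ≫ B ◁ u.proj (X.obj h)) ▷ B') ≫ (α_ _ _ _).hom) hf =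
        ((α_ _ _ _).inv ≫ descentHom h b hX B ▷ B' ≫ (α_ _ _ _).hom) ≫
          B ◁ (descentHom h b hX B' ≫ B' ◁ u.proj (X.obj h)) := by
      rw [descentHom_proj h b hX B' (supp_proj_whiskerRight h hX B')]
      have e : ((α_ _ _ _).inv ≫ (descentHom h b hX B ≫ B ◁ u.proj (X.obj h)) ▷ B') ≫
          (α_ _ _ _).hom = ((α_ _ _ _).inv ≫ descentHom h b hX B ▷ B' ≫ (α_ _ _ _).hom) ≫
            B ◁ (u.proj (X.obj h) ▷ B') := by simp
      refine (app_congr _ h e hf (e ▸ hf)).trans (app_whiskerLeft (const B) _ h _ _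
        (supp_proj_whiskerRight h hX B') (e ▸ hf))
    simp only [app_comp, app_associator_hom, app_associator_inv]
    have hf₁ := supp_app (α_ X (const B) (const B')).inv h _ hp'
    have hf₂ := supp_app (α_ (const B) X (const B')).hom h _
      (supp_app ((b.β (const B)).hom ▷ const B') h _ hf₁)
    have k₁ := congrArg (· ≫ (α_ B (X.obj h) B').hom) (E₁ hf₁)
    have hf₃ := k₁.subst (motive := fun f => Supp ((const B ⊗ X ⊗ const B').supp h ⊓ _) f) hf₂
    refine (congrArg (· ≫ (α_ B B' (X.obj h)).inv)
      ((app_congr _ h k₁ hf₂ hf₃).trans (E₂ hf₃))).trans ?_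
    simp
  naturality {B B'} f := by
    have hp := supp_proj_whiskerRight (X := X) h hX B
    let f' : (const B : Sections (LowerSet.Iic u.toZI)) ⟶ const B' :=
      ofHom (fun _ => f) fun _ => le_top
    have e := app_hom_congr (b.naturality f') h _ hp
    have e₁ : app (X ◁ f') h (u.proj (X.obj h) ▷ B) hp =
        (X.obj h ⊗ u.dom) ◁ f ≫ u.proj (X.obj h) ▷ B' :=
      (app_whiskerLeft_ofHom X (X := const B) (Y := const B') (fun _ => f) (fun _ => le_top) h _
        hp).trans (whisker_exchange _ _).symm
    rw [← cancel_mono (B' ◁ u.proj (X.obj h))]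
    dsimp only
    rw [Category.assoc, Category.assoc, descentHom_proj h b hX B' (supp_proj_whiskerRight h hX B'),
      ← app_comp_left _ h _ _ _ ((supp_proj_whiskerRight h hX B').precomp _),
      ← whisker_exchange, reassoc_of% descentHom_proj h b hX B hp]
    refine (app_congr _ h e₁.symm _ (supp_app _ _ _ _)).trans (e.trans ?_)
    rw [app_comp]
    exact app_whiskerRight_ofHom (X := const B) (Y := const B') (fun _ => f) (fun _ => le_top) X h
      (app (b.β (const B)).hom h (u.proj (X.obj h) ▷ B) hp) (supp_app _ _ _ _)

end Descent

end Sections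

end Stalk

/-! ### Descent of central idempotents from sections over `↓u` to `C` -/

section StalkLocality

variable {C : Type*} [Category C] [MonoidalCategory C]

theorem Supp.exists_comp_tensorHom_of_Iic {u : CentralIdempotent C} {A B T : C} {f : T ⟶ A ⊗ B}
    (hf : Supp (LowerSet.Iic u.toZI) f) :
    ∃ g : T ⟶ (A ⊗ u.dom) ⊗ (B ⊗ u.dom), g ≫ (u.proj A ⊗ₘ u.proj B) = f := by
  obtain ⟨v, hv, g, rfl⟩ := hf.exists_eq_comp_tensorHom
  obtain ⟨m, hm⟩ := CentralIdempotent.toZI_le_toZI.1 hv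
  refine ⟨g ≫ (A ◁ m.f ⊗ₘ B ◁ m.f), ?_⟩
  rw [Category.assoc, tensorHom_comp_tensorHom, v.whiskerLeft_proj u m hm,
    v.whiskerLeft_proj u m hm]

namespace Sections

variable {u : CentralIdempotent C} (h : (LowerSet.Iic u.toZI : Set (ZI C)).Nonempty)

theorem supp_proj {X : Sections (LowerSet.Iic u.toZI)} (hX : u.toZI ∈ X.supp h) :
    Supp (X.supp h ⊓ LowerSet.Iic u.toZI) (u.proj (X.obj h)) :=
  Supp.proj (J := X.supp h ⊓ LowerSet.Iic u.toZI) ⟨hX, LowerSet.mem_Iic_iff.2 le_rfl⟩ _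

variable [hC : Fact (IsStiff C)] {w : CentralIdempotent (Sections (LowerSet.Iic u.toZI))}

/-- The morphism to the tensor unit of `C` induced by a central idempotent of sections. -/
noncomputable def descentMor (hw : u.toZI ∈ w.dom.supp h) : w.dom.obj h ⊗ u.dom ⟶ 𝟙_ C :=
  app w.mor h (u.proj (w.dom.obj h)) (supp_proj h hw)

theorem app_whiskerRight_whiskerRight {W : LowerSet (ZI C)} {X Y : Sections W} (φ : X ⟶ Y)
    (Z : Sections W) (h : (W : Set (ZI C)).Nonempty) {S : C} (k : S ⟶ X.obj h)
    (hk : Supp (X.supp h ⊓ W) k) (hf) :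
    app (φ ▷ Z) h (k ▷ Z.obj h) hf = app φ h k hk ▷ Z.obj h := by
  have e := app_whiskerRight φ Z h (𝟙 _) k hk (hf.precomp _)
  simpa only [Category.id_comp] using e

theorem descentMor_comm (hw : u.toZI ∈ w.dom.supp h) (B : C) :
    descentMor h hw ▷ B ≫ (λ_ B).hom ≫ (ρ_ B).inv =
      descentHom h w.obj.2 hw B ≫ B ◁ descentMor h hw := by
  have hp := supp_proj_whiskerRight h hw B
  have e : app (w.mor ▷ const B) h (u.proj (w.dom.obj h) ▷ B) hp ≫ (λ_ B).hom ≫ (ρ_ B).inv =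
      app (const B ◁ w.mor) h (app (w.obj.2.β (const B)).hom h (u.proj (w.dom.obj h) ▷ B) hp)
        (supp_app _ _ _ _) :=
    (Category.assoc _ _ _).symm.trans (app_hom_congr (w.hom.comm (const B)) h _ hp)
  have e₁ := app_whiskerRight_whiskerRight w.mor (const B) h _ (supp_proj h hw) hp
  have e₂ := descentHom_proj h w.obj.2 hw B hp
  have hf := e₂.symm.subst (motive := fun f => Supp ((const B ⊗ w.dom).supp h ⊓ _) f)
    (supp_app _ _ _ _)
  exact (congrArg (· ≫ (λ_ B).hom ≫ (ρ_ B).inv) e₁).symm.trans (e.trans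
    ((app_congr _ h e₂.symm _ hf).trans
      (app_whiskerLeft (const B) w.mor h _ _ (supp_proj h hw) hf)))

/-- The axioms of a central idempotent are transferred to `C` by evaluation at `u.proj ⊗ u.proj`,
through which every morphism supported in `↓u` factors. -/
theorem central_app (hw : u.toZI ∈ w.dom.supp h) (hf) :
    app (w.mor ▷ w.dom ≫ (λ_ w.dom).hom) h
      (u.proj (w.dom.obj h) ⊗ₘ u.proj (w.dom.obj h)) hf =
    descentMor h hw ▷ (w.dom.obj h ⊗ u.dom) ≫ (λ_ _).hom ≫ u.proj (w.dom.obj h) := by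
  rw [app_comp]
  refine (congrArg (· ≫ (λ_ (w.dom.obj h)).hom)
    (app_whiskerRight_tensorHom w.mor w.dom h _ (supp_proj h hw) _ hf)).trans ?_
  change (descentMor h hw ⊗ₘ u.proj (w.dom.obj h)) ≫ (λ_ (w.dom.obj h)).hom = _
  simp [MonoidalCategory.tensorHom_def]

theorem central_app' (hw : u.toZI ∈ w.dom.supp h) (hf) :
    app (w.dom ◁ w.mor ≫ (ρ_ w.dom).hom) h
      (u.proj (w.dom.obj h) ⊗ₘ u.proj (w.dom.obj h)) hf =
    (w.dom.obj h ⊗ u.dom) ◁ descentMor h hw ≫ (ρ_ _).hom ≫ u.proj (w.dom.obj h) := by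
  rw [app_comp]
  refine (congrArg (· ≫ (ρ_ (w.dom.obj h)).hom)
    (app_whiskerLeft_tensorHom w.dom w.mor h _ _ (supp_proj h hw) hf)).trans ?_
  change (u.proj (w.dom.obj h) ⊗ₘ descentMor h hw) ≫ (ρ_ (w.dom.obj h)).hom = _
  simp [MonoidalCategory.tensorHom_def']

theorem supp_proj_tensorHom_proj {X : Sections (LowerSet.Iic u.toZI)} (hX : u.toZI ∈ X.supp h) :
    Supp ((X ⊗ X).supp h ⊓ LowerSet.Iic u.toZI) (u.proj (X.obj h) ⊗ₘ u.proj (X.obj h)) :=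
  ((supp_proj h hX).tensorHom (supp_proj h hX)).mono
    (le_inf (inf_le_inf inf_le_left inf_le_left) (inf_le_left.trans inf_le_right))

/-- The central idempotent of `C` induced by a central idempotent of sections over `↓u`. -/
noncomputable def descent (hw : u.toZI ∈ w.dom.supp h) : CentralIdempotent C where
  obj := ⟨w.dom.obj h ⊗ u.dom, descentHalfBraiding h w.obj.2 hw⟩
  hom := ⟨descentMor h hw, descentMor_comm h hw⟩
  central := Center.ext _ _ (by
    have hp := supp_proj_tensorHom_proj h hw
    have e := (central_app h hw hp).symm.trans
      ((app_hom_congr (congrArg Center.Hom.f w.central) h _ hp).trans (central_app' h hw hp))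
    rw [← Category.assoc, ← Category.assoc] at e
    exact (cancel_mono _).1 e)
  isIso := by
    have hp := supp_proj_tensorHom_proj h hw
    have hI : IsIso (w.mor ▷ w.dom ≫ (λ_ w.dom).hom) := by
      have := w.isIso
      exact inferInstanceAs (IsIso ((Center.forget _).map (w.hom ▷ w.obj ≫ (λ_ w.obj).hom)))
    obtain ⟨r, hr, hr'⟩ := hI
    have key : IsIso (descentMor h hw ▷ (w.dom.obj h ⊗ u.dom) ≫ (λ_ _).hom) := by
      have hq := supp_proj h hw
      -- The inverse `r` evaluated at `u.proj` factors through `u.proj ⊗ u.proj`; the factor `t` is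
      -- the inverse in `C`.
      obtain ⟨t, ht⟩ := Supp.exists_comp_tensorHom_of_Iic
        ((supp_app r h _ hq).mono inf_le_right)
      have hm : Mono (u.proj (w.dom.obj h) ⊗ₘ u.proj (w.dom.obj h)) := by
        rw [MonoidalCategory.tensorHom_def]
        infer_instance
      have e := (central_app h hw hp).trans (Category.assoc _ _ _).symm
      refine ⟨t, ?_, ?_⟩
      · rw [← cancel_mono (u.proj (w.dom.obj h) ⊗ₘ u.proj (w.dom.obj h)), Category.assoc, ht,
          Category.id_comp]
        refine (app_comp_left r h _ _ hq (hq.precomp _)).symm.trans ?_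
        exact (app_congr r h e.symm _ (supp_app _ _ _ _)).trans (app_hom_congr hr h _ hp)
      · rw [← cancel_mono (u.proj (w.dom.obj h)), Category.assoc, ← e, Category.id_comp]
        refine (app_comp_left _ h _ _ hp (hp.precomp _)).symm.trans ?_
        exact (app_congr _ h ht _ (supp_app _ _ _ _)).trans (app_hom_congr hr' h _ hq)
    exact @Center.isIso_of_f_isIso _ _ _ _ _ _ key

end Sections

end StalkLocality

/-! ### Locality of the stalks -/

section StalkLocality

variable {C : Type*} [Category C] [MonoidalCategory C]

theorem CentralIdempotent.proj_unit (u : CentralIdempotent C) :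
    u.proj (𝟙_ C) = (λ_ u.dom).hom ≫ u.mor := by
  rw [CentralIdempotent.proj, ← unitors_equal, leftUnitor_naturality]

theorem Supp.exists_comp_proj_of_Iic {u : CentralIdempotent C} {A T : C} {f : T ⟶ A}
    (hf : Supp (LowerSet.Iic u.toZI) f) : ∃ g : T ⟶ A ⊗ u.dom, g ≫ u.proj A = f :=
  Supp.exists_eq_of_Iic (Φ := 𝟭 C) (fun _ _ => ⟨Iso.refl _, Category.id_comp _⟩) u hf

theorem Supp.exists_comp_mor_of_unit {J : LowerSet (ZI C)} {T : C} {f : T ⟶ 𝟙_ C}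
    (hf : Supp J f) : ∃ v : CentralIdempotent C, v.toZI ∈ J ∧ ∃ g : T ⟶ v.dom, g ≫ v.mor = f := by
  obtain ⟨v, hv, g, rfl⟩ := hf
  exact ⟨v, hv, g ≫ (λ_ v.dom).hom, by rw [v.proj_unit, Category.assoc]⟩

theorem Supp.comp_mor {J : LowerSet (ZI C)} {v : CentralIdempotent C} (hv : v.toZI ∈ J) {T : C}
    (g : T ⟶ v.dom) : Supp J (g ≫ v.mor) :=
  ⟨v, hv, g ≫ (λ_ v.dom).inv, by rw [v.proj_unit, Category.assoc, Iso.inv_hom_id_assoc]⟩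

variable [hC : Fact (IsStiff C)]

namespace Sections

theorem exists_factor_idealInclusion {W J : LowerSet (ZI C)} {X : Sections W}
    (φ : X ⟶ 𝟙_ (Sections W)) (H : ∀ (h : (W : Set (ZI C)).Nonempty) {T : C} (f : T ⟶ X.obj h)
      (hf : Supp (X.supp h ⊓ W) f), Supp J (app φ h f hf)) :
    ∃ k : X ⟶ idealObj J, k ≫ idealInclusion J = φ :=
  ⟨Hom.mk (fun h _ f hf => app φ h f hf)
    (fun h _ f hf => (H h f hf).inf ((supp_app φ h f hf).mono inf_le_right))
    (fun h _ _ g f hf => app_comp_left φ h g f hf _),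
    hom_ext fun h _ f hf => app_idealInclusion J h (app φ h f hf)
      ((H h f hf).inf ((supp_app φ h f hf).mono inf_le_right))⟩

/-- Over `↓u`, supported morphisms into `X` factor uniquely through `A ⊗ U`, so by the Yoneda
argument one supported `q` defines a morphism of sections. -/
theorem exists_hom_of_Iic {u : CentralIdempotent C} {X Y : Sections (LowerSet.Iic u.toZI)}
    (h : (LowerSet.Iic u.toZI : Set (ZI C)).Nonempty) (q : X.obj h ⊗ u.dom ⟶ Y.obj h)
    (hq : Supp (Y.supp h ⊓ LowerSet.Iic u.toZI) q) :
    ∃ φ : X ⟶ Y, ∀ {T : C} (g : T ⟶ X.obj h ⊗ u.dom) (hf),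
      app φ h (g ≫ u.proj (X.obj h)) hf = g ≫ q := by
  have H {T : C} (f : T ⟶ X.obj h) (hf : Supp (X.supp h ⊓ LowerSet.Iic u.toZI) f) :=
    (hf.mono inf_le_right).exists_comp_proj_of_Iic
  refine ⟨Hom.mk (fun _ _ f hf => (H f hf).choose ≫ q) (fun _ _ f hf => hq.precomp _)
    (fun _ S _ g f hf => ?_), fun g hf => ?_⟩
  · rw [← Category.assoc]
    congr 1
    rw [← cancel_mono (u.proj (X.obj h)), Category.assoc, (H f hf).choose_spec]
    exact (H (g ≫ f) (hf.precomp g)).choose_spec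
  · refine congrArg (· ≫ q) ?_
    rw [← cancel_mono (u.proj (X.obj h))]
    exact (H _ hf).choose_spec

theorem isBigveeLocalOrder_Iic (z : ZI C) :
    IsBigveeLocalOrder (ZI (Sections (LowerSet.Iic z))) := by
  obtain ⟨u, rfl⟩ := CentralIdempotent.exists_toZI_eq z
  have h : (LowerSet.Iic u.toZI : Set (ZI C)).Nonempty := ⟨u.toZI, LowerSet.mem_Iic_iff.2 le_rfl⟩
  refine isBigveeLocalOrder_of_forall (ideal (LowerSet.Iio u.toZI)) ?_ fun w => ?_
  -- An inverse would make `u.proj (𝟙_ C)` supported strictly below `u`, giving `u ≤ v < u` for some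
  -- `v`.
  · rintro ⟨ψ, -, hψ⟩
    have hf : Supp ((𝟙_ (Sections (LowerSet.Iic u.toZI))).supp h ⊓ LowerSet.Iic u.toZI)
        (u.proj (𝟙_ C)) := supp_proj h trivial
    have e : app ψ h _ hf = u.proj (𝟙_ C) :=
      (app_idealInclusion _ h _ (supp_app ψ h _ hf)).symm.trans (app_hom_congr hψ h _ hf)
    have hs : Supp (LowerSet.Iio u.toZI) (u.proj (𝟙_ C)) :=
      e ▸ (supp_app ψ h _ hf).mono inf_le_left
    obtain ⟨v, hv, g, hg⟩ := hs.exists_comp_mor_of_unit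
    exact not_le_of_gt hv (CentralIdempotent.toZI_le_of_factor ((λ_ u.dom).inv ≫ g)
      (by rw [Category.assoc, hg, u.proj_unit, Iso.inv_hom_id_assoc]))
  · by_cases hw : u.toZI ∈ w.dom.supp h
    · have hle : (descent h hw).toZI ≤ u.toZI := by
        obtain ⟨g, hg⟩ := ((supp_app w.mor h _ (supp_proj h hw)).mono
          inf_le_right).exists_comp_proj_of_Iic
        refine CentralIdempotent.toZI_le_of_factor (g ≫ (λ_ u.dom).hom) ?_
        exact (Category.assoc _ _ _).trans ((congrArg (g ≫ ·) u.proj_unit.symm).trans hg)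
      rcases hle.lt_or_eq with hlt | heq
      · refine Or.inr (exists_factor_idealInclusion w.mor fun h' T f hf => ?_)
        obtain ⟨g, rfl⟩ := (hf.mono inf_le_right).exists_comp_proj_of_Iic
        rw [app_comp_left w.mor h g _ (supp_proj h hw)]
        exact Supp.comp_mor (v := descent h hw) hlt g
      -- The descended idempotent is isomorphic to `u`; the inverse `l` of this isomorphism induces
      -- the inverse of `w`.
      · obtain ⟨m, hm⟩ := Quotient.exact heq
        obtain ⟨k, l, hm₁, hm₂, hm₃⟩ : ∃ (k : w.dom.obj h ⊗ u.dom ⟶ u.dom)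
            (l : u.dom ⟶ w.dom.obj h ⊗ u.dom),
            k ≫ u.mor = descentMor h hw ∧ k ≫ l = 𝟙 _ ∧ l ≫ k = 𝟙 _ :=
          ⟨m.hom.f, m.inv.f, congrArg Center.Hom.f hm, congrArg Center.Hom.f m.hom_inv_id,
            congrArg Center.Hom.f m.inv_hom_id⟩
        obtain ⟨φ, hφ⟩ := exists_hom_of_Iic (X := 𝟙_ (Sections (LowerSet.Iic u.toZI)))
          (Y := w.dom) h (((λ_ u.dom).hom ≫ l) ≫ u.proj (w.dom.obj h))
          ((supp_proj h hw).precomp _)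
        refine Or.inl ⟨φ, hom_ext fun h' T f hf => ?_, hom_ext fun h' T f hf => ?_⟩
        · obtain ⟨g, rfl⟩ := (hf.mono inf_le_right).exists_comp_proj_of_Iic
          have e : app w.mor h (g ≫ u.proj (w.dom.obj h)) hf =
              (g ≫ k ≫ (λ_ u.dom).inv) ≫ u.proj (𝟙_ C) := by
            refine (app_comp_left w.mor h g _ (supp_proj h hw) hf).trans ?_
            change g ≫ descentMor h hw = _
            rw [u.proj_unit, ← hm₁]
            simp
          rw [app_comp, app_id]
          refine (app_congr φ h e (supp_app w.mor h _ hf) (e ▸ supp_app w.mor h _ hf)).trans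
            ((hφ _ _).trans ?_)
          simp only [Category.assoc, Iso.inv_hom_id_assoc, reassoc_of% hm₂]
        · obtain ⟨g, rfl⟩ := (hf.mono inf_le_right).exists_comp_proj_of_Iic
          have e : app φ h (g ≫ u.proj (𝟙_ C)) hf =
              (g ≫ (λ_ u.dom).hom ≫ l) ≫ u.proj (w.dom.obj h) := by
            exact (hφ g hf).trans (by simp only [Category.assoc])
          rw [app_comp, app_id]
          refine (app_congr w.mor h e (supp_app φ h _ hf) ((supp_proj h hw).precomp _)).trans
            ((app_comp_left w.mor h _ _ (supp_proj h hw) _).trans ?_)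
          change (g ≫ (λ_ u.dom).hom ≫ l) ≫ descentMor h hw = g ≫ u.proj (𝟙_ C)
          simp only [← hm₁, u.proj_unit, Category.assoc, reassoc_of% hm₃]
    -- As `u` is not in the support of `w.dom`, every idempotent of that support below `u` is
    -- strictly below it.
    · refine Or.inr (exists_factor_idealInclusion w.mor fun h' T f hf => ?_)
      obtain ⟨v, hv, g, rfl⟩ := hf.exists_eq_comp_proj
      rw [app_comp_left w.mor h' g _ (Supp.proj hv _)]
      have hne : v.toZI ≠ u.toZI := fun e => hw ((w.dom.supp h).lower e.ge hv.1)
      have hlt : v.toZI ∈ LowerSet.Iio u.toZI := lt_of_le_of_ne hv.2 hne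
      exact (Supp.of_dom hlt _).precomp g

end Sections

end StalkLocality

/-! ### The embedding into global sections -/

section Embedding

variable {C : Type*} [Category C] [MonoidalCategory C]

theorem Supp.id {J : LowerSet (ZI C)} (hJ : ⊤ ∈ J) (A : C) : Supp J (𝟙 A) := by
  have h := (Supp.proj (u := CentralIdempotent.one C) hJ A).precomp (ρ_ A).inv
  have e : (ρ_ A).inv ≫ (CentralIdempotent.one C).proj A = 𝟙 A :=
    (congrArg (fun k => (ρ_ A).inv ≫ k ≫ (ρ_ A).hom) (whiskerLeft_id A (𝟙_ C))).trans (by simp)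
  exact e ▸ h

namespace Sections

variable (W : LowerSet (ZI C))

/-- The functor sending an object of `C` to a section. -/
def constFunctor : C ⥤ Sections W where
  obj A := const A
  map k := ofHom (fun _ => k) fun _ => le_rfl
  map_id _ := hom_ext fun _ _ f _ => Category.comp_id f
  map_comp k l := hom_ext fun _ _ f _ => (Category.assoc f k l).symm

theorem faithful_constFunctor (hW : (W : Set (ZI C)).Nonempty) (hW' : ⊤ ∈ W) :
    (constFunctor W).Faithful where
  map_injective {A B} k l e := by
    have hf : Supp ((⊤ : LowerSet (ZI C)) ⊓ W) (𝟙 A) :=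
      Supp.id (J := ⊤ ⊓ W) ⟨trivial, hW'⟩ A
    have := app_hom_congr e hW (𝟙 A) hf
    exact (Category.id_comp k).symm.trans (this.trans (Category.id_comp l))

/-- The Yoneda argument: as `⊤ ∈ W`, the identity of `A` is supported, and its image determines the
operation. -/
theorem full_constFunctor (hW : (W : Set (ZI C)).Nonempty) (hW' : ⊤ ∈ W) :
    (constFunctor W).Full where
  map_surjective {A B} φ := by
    have hf : Supp ((⊤ : LowerSet (ZI C)) ⊓ W) (𝟙 A) :=
      Supp.id (J := ⊤ ⊓ W) ⟨trivial, hW'⟩ A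
    refine ⟨app φ hW (𝟙 A) hf, hom_ext fun h T f hf' => ?_⟩
    refine (app_comp_left φ h f (𝟙 A) hf (hf.precomp f)).symm.trans ?_
    exact app_congr φ h (Category.comp_id f) _ _

theorem injective_obj_constFunctor (hW : (W : Set (ZI C)).Nonempty) :
    Function.Injective (constFunctor W).obj := fun _ _ e =>
  congrArg (fun X : Sections W => X.obj hW) e

variable [hC : Fact (IsStiff C)]

/-- The comparison of the tensor product of sections with that of `C`. -/
noncomputable def constTensorIso (A B : C) : (const A ⊗ const B : Sections W) ≅ const (A ⊗ B) :=
  ofIso (X := const A ⊗ const B) (Y := const (A ⊗ B)) (fun _ => Iso.refl (A ⊗ B))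
    fun _ => inf_idem ⊤

@[simp]
theorem app_constTensorIso_hom (A B : C) (h : (W : Set (ZI C)).Nonempty) {T : C}
    (f : T ⟶ A ⊗ B) (hf) : app (constTensorIso W A B).hom h f hf = f := Category.comp_id f

theorem app_whiskerRight_constTensorIso_hom (A B : C) (X : Sections W)
    (h : (W : Set (ZI C)).Nonempty) {T : C} (f : T ⟶ (A ⊗ B) ⊗ X.obj h) (hf) :
    app ((constTensorIso W A B).hom ▷ X) h f hf = f := by
  refine (app_whiskerRight_ofHom (X := const A ⊗ const B) (Y := const (A ⊗ B))
    (fun _ => 𝟙 (A ⊗ B)) (fun _ => (inf_idem ⊤).le) X h f hf).trans ?_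
  exact (congrArg (f ≫ ·) (id_whiskerRight _ _)).trans (Category.comp_id f)

theorem app_whiskerLeft_constTensorIso_hom (A B : C) (X : Sections W)
    (h : (W : Set (ZI C)).Nonempty) {T : C} (f : T ⟶ X.obj h ⊗ A ⊗ B) (hf) :
    app (X ◁ (constTensorIso W A B).hom) h f hf = f := by
  refine (app_whiskerLeft_ofHom X (X := const A ⊗ const B) (Y := const (A ⊗ B))
    (fun _ => 𝟙 (A ⊗ B)) (fun _ => (inf_idem ⊤).le) h f hf).trans ?_
  exact (congrArg (f ≫ ·) (whiskerLeft_id _ _)).trans (Category.comp_id f)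

theorem app_constFunctor_map_whiskerRight {A B : C} (k : A ⟶ B) (X : Sections W)
    (h : (W : Set (ZI C)).Nonempty) {T : C} (f : T ⟶ A ⊗ X.obj h) (hf) :
    app ((constFunctor W).map k ▷ X) h f hf = f ≫ k ▷ X.obj h :=
  app_whiskerRight_ofHom (X := const A) (Y := const B) (fun _ => k) (fun _ => le_rfl) X h f hf

theorem app_whiskerLeft_constFunctor_map {A B : C} (k : A ⟶ B) (X : Sections W)
    (h : (W : Set (ZI C)).Nonempty) {T : C} (f : T ⟶ X.obj h ⊗ A) (hf) :
    app (X ◁ (constFunctor W).map k) h f hf = f ≫ X.obj h ◁ k :=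
  app_whiskerLeft_ofHom X (X := const A) (Y := const B) (fun _ => k) (fun _ => le_rfl) h f hf

noncomputable instance : (constFunctor W).LaxMonoidal where
  ε := 𝟙 (𝟙_ (Sections W))
  μ A B := (constTensorIso W A B).hom
  μ_natural_left {A B} k Z := hom_ext fun h T f hf => by
    refine (app_constTensorIso_hom W B Z h _ (supp_app _ h f hf)).trans
      ((app_constFunctor_map_whiskerRight W k (const Z) h f hf).trans ?_)
    exact (congrArg (· ≫ k ▷ Z) (app_constTensorIso_hom W A Z h f hf)).symm
  μ_natural_right {A B} Z k := hom_ext fun h T f hf => by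
    refine (app_constTensorIso_hom W Z B h _ (supp_app _ h f hf)).trans
      ((app_whiskerLeft_constFunctor_map W k (const Z) h f hf).trans ?_)
    exact (congrArg (· ≫ Z ◁ k) (app_constTensorIso_hom W Z A h f hf)).symm
  associativity A B Z := hom_ext fun h T f hf => by
    refine (congrArg (· ≫ (α_ A B Z).hom)
      ((app_constTensorIso_hom W (A ⊗ B) Z h _ (supp_app _ h f hf)).trans
      (app_whiskerRight_constTensorIso_hom W A B (const Z) h f hf))).trans ?_
    exact ((app_constTensorIso_hom W A (B ⊗ Z) h _ (supp_app _ h _ _)).trans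
      (app_whiskerLeft_constTensorIso_hom W B Z (const A) h (f ≫ (α_ A B Z).hom)
        (supp_app (α_ (const A) (const B) (const Z)).hom h f hf))).symm
  left_unitality A := hom_ext fun h T f hf => by
    refine (congrArg (· ≫ (λ_ A).hom) ?_).symm
    refine (app_constTensorIso_hom W (𝟙_ C) A h _ (supp_app _ h f hf)).trans ?_
    exact app_hom_congr (id_whiskerRight (𝟙_ (Sections W)) (const A)) h f hf
  right_unitality A := hom_ext fun h T f hf => by
    refine (congrArg (· ≫ (ρ_ A).hom) ?_).symm
    refine (app_constTensorIso_hom W A (𝟙_ C) h _ (supp_app _ h f hf)).trans ?_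
    exact app_hom_congr (whiskerLeft_id (const A) (𝟙_ (Sections W))) h f hf

instance : IsIso (ε (constFunctor W)) := inferInstanceAs (IsIso (𝟙 (𝟙_ (Sections W))))

instance (A B : C) : IsIso (μ (constFunctor W) A B) :=
  inferInstanceAs (IsIso (constTensorIso W A B).hom)

theorem isMonoidalEmbedding_constFunctor (hW : ⊤ ∈ W) :
    IsMonoidalEmbedding (constFunctor W) where
  full := full_constFunctor W ⟨⊤, hW⟩ hW
  faithful := faithful_constFunctor W ⟨⊤, hW⟩ hW
  injective_obj := injective_obj_constFunctor W ⟨⊤, hW⟩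
  isIso_unit := inferInstance
  isIso_tensor _ _ := inferInstance

/-- The chosen half-braidings act by composition with those of `C`, and the coherences act as
identities, so each condition reduces to an identity in the centre of `C`. -/
theorem preservesCentralIdempotents_constFunctor :
    PreservesCentralIdempotents (constFunctor W) := by
  refine ⟨inferInstance, fun _ _ => inferInstance, fun u => liftHalfBraiding ⊤ u.obj.2,
    fun u A => hom_ext fun h T f hf => ?_, fun X => hom_ext fun h T f hf => ?_,
    fun u v X => hom_ext fun h T f hf => ?_, fun u X => hom_ext fun h T f hf => ?_⟩
  · exact (app_constTensorIso_hom W A u.dom h (f ≫ (u.braid A).hom)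
      (supp_app ((liftHalfBraiding ⊤ u.obj.2).β (const A)).hom h f hf)).trans
      (congrArg (· ≫ (u.braid A).hom) (app_constTensorIso_hom W u.dom A h f hf)).symm
  · have e {T : C} (f : T ⟶ X.obj h ⊗ 𝟙_ C) (hf) :
        app (X ◁ ε (constFunctor W)) h f hf = f :=
      app_hom_congr (whiskerLeft_id X (𝟙_ (Sections W))) h f hf
    refine (congrArg (· ≫ ((CentralIdempotent.one C).braid (X.obj h)).hom)
      (app_hom_congr (id_whiskerRight (𝟙_ (Sections W)) X) h f hf)).trans ?_
    exact (Category.assoc _ _ _).symm.trans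
      (e ((f ≫ (λ_ (X.obj h)).hom) ≫ (ρ_ (X.obj h)).inv)
        (supp_app ((λ_ X).hom ≫ (ρ_ X).inv) h f hf)).symm
  · refine (congrArg (· ≫ ((u.tensor v).braid (X.obj h)).hom)
      (app_whiskerRight_constTensorIso_hom W u.dom v.dom X h f hf)).trans ?_
    -- Evaluating a composite of sections at `f` brackets to the left, so the composite in `C` is
    -- rebracketed to match.
    have hassoc {P₀ P₁ P₂ P₃ P₄ P₅ P₆ : C} (f : P₀ ⟶ P₁) (a : P₁ ⟶ P₂) (b : P₂ ⟶ P₃)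
        (c : P₃ ⟶ P₄) (d : P₄ ⟶ P₅) (e : P₅ ⟶ P₆) :
        f ≫ a ≫ b ≫ c ≫ d ≫ e = ((((f ≫ a) ≫ b) ≫ c) ≫ d) ≫ e := by
      simp only [Category.assoc]
    refine (hassoc f (α_ u.dom v.dom (X.obj h)).hom (u.dom ◁ (v.braid (X.obj h)).hom)
      (α_ u.dom (X.obj h) v.dom).inv ((u.braid (X.obj h)).hom ▷ v.dom)
      (α_ (X.obj h) u.dom v.dom).hom).trans ?_
    let β (w : CentralIdempotent C) : const w.dom ⊗ X ≅ X ⊗ const w.dom :=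
      (liftHalfBraiding ⊤ w.obj.2).β X
    have e₁ : app (const u.dom ◁ (β v).hom) h (f ≫ (α_ u.dom v.dom (X.obj h)).hom)
        (supp_app (α_ (const u.dom) (const v.dom) X).hom h f hf) =
        (f ≫ (α_ u.dom v.dom (X.obj h)).hom) ≫ u.dom ◁ (v.braid (X.obj h)).hom :=
      app_whiskerLeft_ofHom (const u.dom) (X := const v.dom ⊗ X) (Y := X ⊗ const v.dom)
        (fun h => (v.braid (X.obj h)).hom) (fun _ => (inf_comm _ _).le) h _ _
    have e₂ {T : C} (f : T ⟶ (u.dom ⊗ X.obj h) ⊗ v.dom) (hf) :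
        app ((β u).hom ▷ const v.dom) h f hf = f ≫ (u.braid (X.obj h)).hom ▷ v.dom :=
      app_whiskerRight_ofHom (X := const u.dom ⊗ X) (Y := X ⊗ const u.dom)
        (fun h => (u.braid (X.obj h)).hom) (fun _ => (inf_comm _ _).le) (const v.dom) h f hf
    let φ : (const u.dom ⊗ const v.dom) ⊗ X ⟶ (const u.dom ⊗ X) ⊗ const v.dom :=
      (α_ _ _ _).hom ≫ const u.dom ◁ (β v).hom ≫ (α_ _ _ _).inv
    have e₃ : app φ h f hf = ((f ≫ (α_ u.dom v.dom (X.obj h)).hom) ≫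
        u.dom ◁ (v.braid (X.obj h)).hom) ≫ (α_ u.dom (X.obj h) v.dom).inv :=
      congrArg (· ≫ (α_ u.dom (X.obj h) v.dom).inv) e₁
    have e₄ : app (φ ≫ (β u).hom ▷ const v.dom) h f hf = app φ h f hf ≫
        (u.braid (X.obj h)).hom ▷ v.dom := e₂ _ (supp_app φ h f hf)
    refine Eq.trans ?_ (app_whiskerLeft_constTensorIso_hom W u.dom v.dom X h
      (app (φ ≫ (β u).hom ▷ const v.dom) h f hf ≫ (α_ (X.obj h) u.dom v.dom).hom)
      (supp_app ((φ ≫ (β u).hom ▷ const v.dom) ≫ (α_ _ _ _).hom) h f hf)).symm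
    rw [e₄, e₃]
  · refine (congrArg (· ≫ ((CentralIdempotent.one C).braid (X.obj h)).hom)
      (app_constFunctor_map_whiskerRight W u.mor X h f hf)).trans ?_
    refine Eq.trans ?_ (app_whiskerLeft_constFunctor_map W u.mor X h (f ≫ (u.braid (X.obj h)).hom)
      (supp_app ((liftHalfBraiding ⊤ u.obj.2).β X).hom h f hf)).symm
    exact (Category.assoc _ _ _).trans ((congrArg (f ≫ ·) (u.hom.comm (X.obj h))).trans
      (Category.assoc _ _ _).symm)

end Sections

end Embedding

theorem hasCentralEmbedding_structureSheaf (C : Type u) [SmallCategory C] [MonoidalCategory C]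
    [hC : Fact (IsStiff C)] :
    HasCentralEmbedding (MonCategory.of C) (globalSections (structureSheaf C)) :=
  ⟨MonCategory.Hom.mk (C := MonCategory.of C)
      (D := MonCategory.of (Sections (opensToLowerSet (⊤ : Opens (spectrum C)))))
      (Sections.constFunctor _)
      (isIso_unit := inferInstanceAs (IsIso (ε (Sections.constFunctor _)))),
    Sections.isMonoidalEmbedding_constFunctor _ trivial,
    Sections.preservesCentralIdempotents_constFunctor _⟩

end TensorTopology

theorem mainTheorem3 (C : Type u) [SmallCategory C] [MonoidalCategory C]
    (hC : TensorTopology.IsStiff C) :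
    (∃ (X : TopCat.{u}) (F : TopCat.Presheaf TensorTopology.MonCategory.{u} X),
      TensorTopology.IsSheafOf TensorTopology.MonCategory.IsVeeLocal F ∧
      TensorTopology.HasCentralEmbedding
        (TensorTopology.MonCategory.of C) (TensorTopology.globalSections F)) ∧
    (∃ (X : TopCat.{u}) (F : TopCat.Presheaf TensorTopology.MonCategory.{u} X),
      TensorTopology.IsSheafOf TensorTopology.MonCategory.IsBigveeLocal F ∧
      TensorTopology.HasCentralEmbedding
        (TensorTopology.MonCategory.of C) (TensorTopology.globalSections F)) := by
  have : Fact (TensorTopology.IsStiff C) := ⟨hC⟩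
  have hE := TensorTopology.hasCentralEmbedding_structureSheaf C
  exact ⟨⟨_, _, TensorTopology.isSheafOf_structureSheaf C _ fun z =>
      (TensorTopology.Sections.isBigveeLocalOrder_Iic z).isVeeLocalOrder, hE⟩,
    ⟨_, _, TensorTopology.isSheafOf_structureSheaf C _
      TensorTopology.Sections.isBigveeLocalOrder_Iic, hE⟩⟩
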